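/- **Setting.** For $\alpha>1/2$, weights $\boldsymbol\gamma=(\gamma_1,\gamma_2,\ldots)$ with $\gamma_j\ge 0$, and $\boldsymbol k\in\mathbb Z^d$, let $r_{\alpha,\boldsymbol\gamma}(\boldsymbol k)=\prod_{1\le j\le d,\,k_j\ne 0}|k_j|^{\alpha}/\gamma_j\in[0,\infty]$, where a factor with $\gamma_j=0$ is $\infty$. The weighted Korobov space $H_{\alpha,\boldsymbol\gamma}$ consists of the functions $f:[0,1]^d\to\mathbb R$, one-periodic in each variable, that equal everywhere the sum of their absolutely convergent Fourier series $\sum_{\boldsymbol k\in\mathbb Z^d}\hat f(\boldsymbol k)e^{2\pi i\boldsymbol k\cdot\boldsymbol x}$, with $\|f\|_{\alpha,\boldsymbol\gamma}=\big(\sum_{\boldsymbol k}|\hat f(\boldsymbol k)|^2 r_{\alpha,\boldsymbol\gamma}(\boldsymbol k)^2\big)^{1/2}<\infty$ (with $0\cdot\infty=0$). Write $I(f)=\int_{[0,1]^d}f(\boldsymbol x)\,d\boldsymbol x$, and $Q_P(f)=|P|^{-1}\sum_{\boldsymbol x\in P}f(\boldsymbol x)$ for a finite set $P\subset[0,1]^d$.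 For $N\ge 2$ and $\boldsymbol z\in\{1,\ldots,N-1\}^d$ let $P_{N,\boldsymbol z}=\{(\{nz_1/N\},\ldots,\{nz_d/N\}):0\le n<N\}$, where $\{x\}$ is the fractional part of $x$, and let $e^{\mathrm{wor}}(N,\boldsymbol z)=\sup_{\|f\|_{\alpha,\boldsymbol\gamma}\le 1}|I(f)-Q_{P_{N,\boldsymbol z}}(f)|$. **The shifted randomized lattice rule $\tilde A^{\mathrm{ran}}_{r,M}$** ($r,M\in\mathbb N$, $r\ge 1$, $M\ge 2$). Draw $N$ uniformly from the primes $p$ with $\lceil M/2\rceil<p\le M$. Given $N$, draw $\boldsymbol z_1,\ldots,\boldsymbol z_r$ independently and uniformly from $\{1,\ldots,N-1\}^d$. Let $\boldsymbol z^*$ be one of $\boldsymbol z_1,\ldots,\boldsymbol z_r$ that minimizes $e^{\mathrm{wor}}(N,\boldsymbol z_j)$ (ties are broken by an arbitrary rule depending only on $N,\boldsymbol z_1,\ldots,\boldsymbol z_r$). Independently draw $\boldsymbol\Delta$ uniformly from $[0,1]^d$, and use $Q_{P_{N,\boldsymbol z^*}+\boldsymbol\Delta}$, where $P+\boldsymbol\Delta=\{(\{x_1+\Delta_1\},\ldots,\{x_d+\Delta_d\}):\boldsymbol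 x\in P\}$. Its worst-case root-mean-squared error is $$e^{\mathrm{rms}}(H_{\alpha,\boldsymbol\gamma};\tilde A^{\mathrm{ran}}_{r,M})=\sup_{\|f\|_{\alpha,\boldsymbol\gamma}\le 1}\Big(\mathbb E_{N,\boldsymbol z_1,\ldots,\boldsymbol z_r,\boldsymbol\Delta}\big[|I(f)-Q_{P_{N,\boldsymbol z^*}+\boldsymbol\Delta}(f)|^2\big]\Big)^{1/2}.$$ **Theorem.** There are constants $C_{\lambda,\delta}>0$, depending only on $\lambda$ and $\delta$, such that the following holds. Let $d\in\mathbb N$, let $\alpha>1/2$ be real, let $\boldsymbol\gamma$ be a sequence of weights with $0\le\gamma_j\le 1$ for all $j$, let $r,M\in\mathbb N$ with $r\ge 1$ and $M\ge 2$, and let $\eta\in(0,1)$. Assume that $$(1-\eta)M\ \ge\ \inf_{1/2\le\lambda<\alpha}\ 2\prod_{j=1}^d\big(1+2\gamma_j^{1/\lambda}\zeta(\alpha/\lambda)\big),$$ where $\zeta$ is the Riemann zeta function. Then for all $1/2\le\lambda<\alpha$ and $0<\delta\le 1/\alpha$, $$\big(e^{\mathrm{rms}}(H_{\alpha,\boldsymbol\gamma};\tilde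 A^{\mathrm{ran}}_{r,M})\big)^2\ \le\ \frac{r\,C_{\lambda,\delta}}{\alpha(1-\eta)^{\lambda(2-\delta)}M^{\lambda(2-\delta)+1}}\prod_{j=1}^d\big(1+2\gamma_j^{1/\lambda}\zeta(\alpha/\lambda)\big)^{\lambda(2-\delta)}+(1-\eta)^r.$$ -/

import Mathlib

open scoped ENNReal NNReal

/-- The closed unit cube `[0,1]^d` in `ℝ^d`. -/
def unitCube (d : ℕ) : Set (Fin d → ℝ) := Set.Icc 0 1

/-- The integral `I(f)` of `f` over the unit cube. -/
noncomputable def cubeIntegral {d : ℕ} (f : (Fin d → ℝ) → ℝ) : ℝ :=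
  ∫ x in unitCube d, f x

/-- The Fourier mode `x ↦ exp (2 π i k·x)`. -/
noncomputable def fourierMode {d : ℕ} (k : Fin d → ℤ) (x : Fin d → ℝ) : ℂ :=
  Complex.exp (2 * Real.pi * Complex.I * ((∑ j, (k j : ℝ) * x j : ℝ) : ℂ))

/-- The Fourier coefficient `∫ f(x) exp (-2 π i k·x) dx` over the unit cube. -/
noncomputable def cubeFourierCoeff {d : ℕ} (f : (Fin d → ℝ) → ℝ) (k : Fin d → ℤ) : ℂ :=
  ∫ x in unitCube d, (f x : ℂ) * fourierMode (-k) x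

/-- The function `r(k) = ∏ |k_j|^α / γ_j` over the coordinates with `k_j ≠ 0`. Its values lie in
`[0,∞]`, where a factor with `γ_j = 0` is `∞`. The weights are a sequence indexed from `0`, so the
`d` weights used are `γ 0, …, γ (d-1)`. -/
noncomputable def korobovWeight {d : ℕ} (α : ℝ) (γ : ℕ → ℝ≥0) (k : Fin d → ℤ) : ℝ≥0∞ :=
  ∏ j ∈ Finset.univ.filter (fun j => k j ≠ 0),
    ENNReal.ofReal (|(k j : ℝ)| ^ α) / (γ j : ℝ≥0∞)

/-- The Korobov norm `(∑ |f̂(k)|² r(k)²)^(1/2)`, with values in `[0,∞]` and with `0 * ∞ = 0`. It is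
finite only if the coefficient of every frequency with `r(k) = ∞` vanishes. -/
noncomputable def korobovNorm {d : ℕ} (α : ℝ) (γ : ℕ → ℝ≥0) (f : (Fin d → ℝ) → ℝ) : ℝ≥0∞ :=
  (∑' k : Fin d → ℤ, ‖cubeFourierCoeff f k‖ₑ ^ 2 * korobovWeight α γ k ^ 2) ^ (1 / 2 : ℝ)

/-- Membership in the weighted Korobov space (for `α > 1/2`): real functions on the unit cube which
are everywhere the sum of their absolutely convergent Fourier series and have a finite Korobov
norm. Only the values on the cube matter. The representation by the series contains the
one-periodicity `f(x) = f(y)` whenever `x` and `y` in the cube differ by an integer vector. -/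
structure MemKorobov {d : ℕ} (α : ℝ) (γ : ℕ → ℝ≥0) (f : (Fin d → ℝ) → ℝ) : Prop where
  integrableOn : MeasureTheory.IntegrableOn f (unitCube d)
  summable_coeff : Summable fun k : Fin d → ℤ => ‖cubeFourierCoeff f k‖
  hasSum_fourier : ∀ x ∈ unitCube d,
    HasSum (fun k : Fin d → ℤ => cubeFourierCoeff f k * fourierMode k x) (f x : ℂ)
  norm_lt_top : korobovNorm α γ f < ∞

/-- The unit ball of the weighted Korobov space. -/
def korobovUnitBall (d : ℕ) (α : ℝ) (γ : ℕ → ℝ≥0) : Set ((Fin d → ℝ) → ℝ) :=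
  {f | MemKorobov α γ f ∧ korobovNorm α γ f ≤ 1}

/-- The quasi-Monte Carlo rule over a finite point set. -/
noncomputable def qmcRule {d : ℕ} (P : Finset (Fin d → ℝ)) (f : (Fin d → ℝ) → ℝ) : ℝ :=
  1 / (P.card : ℝ) * ∑ x ∈ P, f x

/-- The worst-case error in the weighted Korobov space of a deterministic cubature rule. -/
noncomputable def worstCaseError {d : ℕ} (α : ℝ) (γ : ℕ → ℝ≥0)
    (Q : ((Fin d → ℝ) → ℝ) → ℝ) : ℝ≥0∞ :=
  ⨆ f ∈ korobovUnitBall d α γ, ENNReal.ofReal |cubeIntegral f - Q f|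

/-- The worst-case root-mean-squared error in the weighted Korobov space of a randomized cubature
rule, that is, of a family of rules indexed by the points of a probability space. -/
noncomputable def worstCaseRMSE {d : ℕ} {Ω : Type*} [MeasurableSpace Ω] (α : ℝ) (γ : ℕ → ℝ≥0)
    (μ : MeasureTheory.Measure Ω) (Q : Ω → ((Fin d → ℝ) → ℝ) → ℝ) : ℝ≥0∞ :=
  ⨆ f ∈ korobovUnitBall d α γ,
    (∫⁻ ω, ENNReal.ofReal (|cubeIntegral f - Q ω f| ^ 2) ∂μ) ^ (1 / 2 : ℝ)

/-- The rank-1 lattice point set with `N` points and generating vector `z`. -/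
noncomputable def latticePoints {d : ℕ} (N : ℕ) (z : Fin d → ℕ) : Finset (Fin d → ℝ) :=
  (Finset.range N).image fun (n : ℕ) (j : Fin d) => Int.fract ((n : ℝ) * (z j : ℝ) / (N : ℝ))

/-- The point set `P + Δ`, shifted modulo one. -/
noncomputable def shiftPoints {d : ℕ} (Δ : Fin d → ℝ) (P : Finset (Fin d → ℝ)) :
    Finset (Fin d → ℝ) :=
  P.image fun x j => Int.fract (x j + Δ j)

/-- The primes `p` with `⌈M/2⌉ < p ≤ M`. In `ℕ`, `(M + 1) / 2` is `⌈M/2⌉`. -/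
def upperPrimes (M : ℕ) : Finset ℕ := (Finset.Ioc ((M + 1) / 2) M).filter Nat.Prime

/-- The set `{1, …, N-1}^d` of generating vectors. -/
def genVectors (d N : ℕ) : Finset (Fin d → ℕ) := Fintype.piFinset fun _ => Finset.Icc 1 (N - 1)

/-- All `r`-tuples of generating vectors. -/
def genTuples (d r N : ℕ) : Finset (Fin r → Fin d → ℕ) := Fintype.piFinset fun _ => genVectors d N

theorem upperPrimes_nonempty {M : ℕ} (hM : 2 ≤ M) : (upperPrimes M).Nonempty := by
  obtain ⟨p, hp, h1, h2⟩ := Nat.exists_prime_lt_and_le_two_mul ((M + 1) / 2) (by omega)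
  refine ⟨p, Finset.mem_filter.2 ⟨Finset.mem_Ioc.2 ⟨h1, ?_⟩, hp⟩⟩
  rcases hp.eq_two_or_odd with h | h <;> omega

theorem genTuples_nonempty (d r : ℕ) {M N : ℕ} (hN : N ∈ upperPrimes M) :
    (genTuples d r N).Nonempty := by
  have h := (Finset.mem_filter.1 hN).2.two_le
  exact ⟨fun _ _ => 1, by simp only [genTuples, genVectors, Fintype.mem_piFinset, Finset.mem_Icc]
                          intros; omega⟩

/-- The law of `(N, (z_1, …, z_r))`: first `N` is drawn uniformly from `upperPrimes M`, then the
`r`-tuple is drawn uniformly from `({1, …, N-1}^d)^r`; that is, given `N`, the `r` vectors are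
independent and uniform on `{1, …, N-1}^d`. -/
noncomputable def drawLaw (d r M : ℕ) (hM : 2 ≤ M) : PMF (ℕ × (Fin r → Fin d → ℕ)) :=
  (PMF.uniformOfFinset (upperPrimes M) (upperPrimes_nonempty hM)).bindOnSupport fun N hN =>
    (PMF.uniformOfFinset (genTuples d r N) (genTuples_nonempty d r
      ((PMF.mem_support_uniformOfFinset_iff (upperPrimes_nonempty hM) N).1 hN))).map (Prod.mk N)

/-- `sel` is a rule for step three of the algorithm: for all possible draws `N, z_1, …, z_r` it
returns an index `j` for which `z_j` minimizes the worst-case error. Ties are broken arbitrarily. -/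
def IsArgminRule {d r : ℕ} (α : ℝ) (γ : ℕ → ℝ≥0) (M : ℕ)
    (sel : ℕ → (Fin r → Fin d → ℕ) → Fin r) : Prop :=
  ∀ N ∈ upperPrimes M, ∀ z ∈ genTuples d r N, ∀ j,
    worstCaseError α γ (qmcRule (latticePoints N (z (sel N z)))) ≤
      worstCaseError α γ (qmcRule (latticePoints N (z j)))

/-- The probability measure behind the shifted rule: `(N, (z_1, …, z_r))` has law `drawLaw`, and
the shift `Δ` is independent of it and uniform on the unit cube. -/
noncomputable def shiftedLaw (d r M : ℕ) (hM : 2 ≤ M) :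
    MeasureTheory.Measure ((ℕ × (Fin r → Fin d → ℕ)) × (Fin d → ℝ)) :=
  (drawLaw d r M hM).toMeasure.prod (MeasureTheory.volume.restrict (unitCube d))

/-- The shifted randomized lattice rule: for the outcome `ω = ((N, (z_1, …, z_r)), Δ)`, the
quasi-Monte Carlo rule over the lattice with `N` points and generating vector `z*`, shifted
by `Δ`. -/
noncomputable def shiftedLatticeRule {d r : ℕ} (sel : ℕ → (Fin r → Fin d → ℕ) → Fin r)
    (ω : (ℕ × (Fin r → Fin d → ℕ)) × (Fin d → ℝ)) : ((Fin d → ℝ) → ℝ) → ℝ :=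
  qmcRule (shiftPoints ω.2 (latticePoints ω.1.1 (ω.1.2 (sel ω.1.1 ω.1.2))))

/-- The factor `1 + 2 γ_j^(1/λ) ζ(α/λ)`; the zeta function is real at the real point `α/λ > 1`. -/
noncomputable def zetaFactor (α : ℝ) (γ : ℕ → ℝ≥0) (lam : ℝ) (j : ℕ) : ℝ :=
  1 + 2 * (γ j : ℝ) ^ (1 / lam) * (riemannZeta ((α / lam : ℝ) : ℂ)).re

open MeasureTheory

/-! Let f lie in the unit ball. The error of a lattice rule shifted by Δ is a Fourier series in Δ,
whose coefficients are those of f at the nonzero dual vectors (`hasSum_errorCoeff`). By Parseval its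
mean square over Δ is ∑ |f̂(k)|² over the nonzero dual vectors of z* (`lintegral_shiftPoints_eq`).
It remains to average over N and the z_j.

Let P be the product of the zeta factors and T = (6P/((1-η)M))^λ. The average over z of e^wor to the
power 1/λ is at most 3P/N. By Markov's inequality at most a fraction 1-η of the generating vectors
have e^wor > T, so all r draws do with probability at most (1-η)^r. In that event the sum is bounded
by ∑ |f̂(k)|² ≤ 1, because r(k) ≥ 1; this is the second term of the bound.

Otherwise e^wor(z*) ≤ T. A cosine test function gives 1/r(k) ≤ e^wor for every nonzero dual k
(`inv_korobovWeight_le_worstCaseError`), so only frequencies with r(k)T ≥ 1 contribute. Since z* is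
one of the z_j, a union bound replaces the selection by r times the probability that k is dual to
one uniform vector. Given N this is at most 2/N, plus 1 if N divides k. A coordinate k_i ≠ 0 is
divisible by at most 2 log|k_i| / log M of the admissible primes, while Chebyshev's bound supplies
at least cM / log M of them. The factors log M cancel, and log|k_i| ≤ r(k)^δ/(αδ) makes the
probability O(r(k)^δ/(αδM)) (`average_dual_probability_le`). Finally r(k)^δ ≤ r(k)² T^(2-δ) where
r(k)T ≥ 1, and ∑ |f̂(k)|² r(k)² ≤ 1 gives the first term. -/

/-! ### Chebyshev's lower bound for primes in dyadic intervals -/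

/-- Erdős's argument for Bertrand's postulate, with the primes in (n, 2n] kept in the count. Prime
powers in the binomial are at most 2n, primes above √(2n) occur at most once, and primes in (2n/3,
n] do not occur. The factor 4^(2n/3) is the primorial bound. -/
theorem Nat.centralBinom_le_mul_pow_card_primes (n : ℕ) (hn : 2 < n) :
    Nat.centralBinom n ≤ (2 * n) ^ Nat.sqrt (2 * n) * 4 ^ (2 * n / 3) *
      (2 * n) ^ ((Finset.Ioc n (2 * n)).filter Nat.Prime).card := by
  classical
  have n2_pos : 1 ≤ 2 * n := by omega
  set f : ℕ → ℕ := fun x => x ^ n.centralBinom.factorization x with hf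
  set U := (Finset.Ioc n (2 * n)).filter Nat.Prime with hU
  set S := (Finset.range (2 * n / 3 + 1)).filter Nat.Prime with hS
  have hle : ∀ p, f p ≤ 2 * n := fun p => Nat.pow_factorization_choose_le (by omega)
  have hdisj : Disjoint S U := by
    rw [Finset.disjoint_left]
    intro p hp hq
    simp only [hS, hU, Finset.mem_filter, Finset.mem_range, Finset.mem_Ioc] at hp hq
    omega
  have hprod : Nat.centralBinom n = ∏ p ∈ S ∪ U, f p := by
    rw [← n.prod_pow_factorization_centralBinom]
    symm
    apply Finset.prod_subset
    · intro p hp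
      simp only [hS, hU, Finset.mem_union, Finset.mem_filter, Finset.mem_range,
        Finset.mem_Ioc] at hp ⊢
      omega
    · intro p hp hq
      by_cases hpp : p.Prime
      · simp only [hS, hU, Finset.mem_union, Finset.mem_filter, Finset.mem_range,
          Finset.mem_Ioc, hpp, and_true] at hp hq
        simp only [hf]
        rw [Nat.factorization_centralBinom_of_two_mul_self_lt_three_mul hn (by omega) (by omega),
          Nat.pow_zero]
      · simp only [hf]
        rw [Nat.factorization_eq_zero_of_not_prime n.centralBinom hpp, Nat.pow_zero]
  rw [hprod, Finset.prod_union hdisj]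
  refine Nat.mul_le_mul ?_ (Finset.prod_le_pow_card _ _ _ fun p _ => hle p)
  rw [← Finset.prod_filter_mul_prod_filter_not S (· ≤ Nat.sqrt (2 * n))]
  apply Nat.mul_le_mul
  · refine (Finset.prod_le_pow_card _ _ _ fun p _ => hle p).trans ?_
    have : (Finset.Icc 1 (Nat.sqrt (2 * n))).card = Nat.sqrt (2 * n) := by
      rw [Nat.card_Icc, Nat.add_sub_cancel]
    refine pow_right_mono₀ n2_pos ((Finset.card_le_card fun x hx => ?_).trans this.le)
    obtain ⟨h1, h2⟩ := Finset.mem_filter.1 hx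
    exact Finset.mem_Icc.mpr ⟨(Finset.mem_filter.1 h1).2.one_lt.le, h2⟩
  · refine le_trans ?_ (primorial_le_four_pow (2 * n / 3))
    refine (Finset.prod_le_prod' fun p hp => (?_ : f p ≤ p)).trans ?_
    · obtain ⟨h1, h2⟩ := Finset.mem_filter.1 hp
      refine (pow_right_mono₀ (Finset.mem_filter.1 h1).2.one_lt.le ?_).trans (pow_one p).le
      exact Nat.factorization_choose_le_one (Nat.sqrt_lt'.mp <| not_le.1 h2)
    refine Finset.prod_le_prod_of_subset_of_one_le' (Finset.filter_subset _ _) ?_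
    exact fun p hp _ => (Finset.mem_filter.1 hp).2.one_lt.le

/-- Compare logarithms in 4^n < n · centralBinom n. The exponent 2n/3 leaves n/3 on the left, and
the factor n accounts for the summand 1. -/
theorem Nat.log_le_card_primes_Ioc_mul_log (n : ℕ) (hn : 4 ≤ n) :
    (n : ℝ) / 3 * Real.log 4 ≤
      ((((Finset.Ioc n (2 * n)).filter Nat.Prime).card : ℝ) + 1 + √(2 * n)) *
        Real.log (2 * n) := by
  set K := ((Finset.Ioc n (2 * n)).filter Nat.Prime).card with hK
  have h1 := (Nat.four_pow_lt_mul_centralBinom n hn).le.trans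
    (Nat.mul_le_mul_left n (Nat.centralBinom_le_mul_pow_card_primes n (by omega)))
  have hn0 : (0 : ℝ) < n := by exact_mod_cast (by omega : 0 < n)
  have h2 : ((4 ^ n : ℕ) : ℝ) ≤ ((n * ((2 * n) ^ Nat.sqrt (2 * n) * 4 ^ (2 * n / 3) *
      (2 * n) ^ K) : ℕ) : ℝ) := by exact_mod_cast h1
  have h3 := Real.log_le_log (by positivity) h2
  push_cast at h3
  rw [Real.log_mul (by positivity) (by positivity), Real.log_mul (by positivity) (by positivity),
    Real.log_mul (by positivity) (by positivity), Real.log_pow, Real.log_pow, Real.log_pow,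
    Real.log_pow] at h3
  have h4 : Real.log n ≤ Real.log (2 * n) := Real.log_le_log hn0 (by linarith)
  have h5 : ((Nat.sqrt (2 * n) : ℕ) : ℝ) ≤ √(2 * n) := by
    have := @Real.nat_sqrt_le_real_sqrt (2 * n)
    exact_mod_cast this
  have h6 : ((2 * n / 3 : ℕ) : ℝ) ≤ 2 * n / 3 := by
    have := @Nat.cast_div_le ℝ _ _ _ (2 * n) 3
    exact_mod_cast this
  have hl : 0 ≤ Real.log (2 * n) := Real.log_nonneg (by
    have : (4 : ℝ) ≤ n := by exact_mod_cast hn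
    linarith)
  have h7 : 0 < Real.log 4 := Real.log_pos (by norm_num)
  have h8 := mul_le_mul_of_nonneg_right h5 hl
  have h9 := mul_le_mul_of_nonneg_right h6 h7.le
  nlinarith

open Filter in
theorem exists_le_card_primes_Ioc_mul_log :
    ∃ c : ℝ, 0 < c ∧ ∀ n : ℕ, 1 ≤ n →
      c * n ≤ (((Finset.Ioc n (2 * n)).filter Nat.Prime).card : ℝ) * Real.log (2 * n) := by
  have hO : (fun x : ℝ => (1 + √x) * Real.log x) =o[atTop] fun x : ℝ => x := by
    have h1 : (fun x : ℝ => 1 + √x) =O[atTop] fun x : ℝ => x ^ (1 / 2 : ℝ) := by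
      refine Asymptotics.IsBigO.of_bound 2 ?_
      filter_upwards [eventually_ge_atTop 1] with x hx
      rw [← Real.sqrt_eq_rpow]
      have : 1 ≤ √x := Real.one_le_sqrt.2 hx
      rw [Real.norm_of_nonneg (by positivity), Real.norm_of_nonneg (by positivity)]
      linarith
    have h2 := h1.mul_isLittleO (isLittleO_log_rpow_atTop (show (0 : ℝ) < 1 / 2 by norm_num))
    refine h2.trans_eventuallyEq ?_
    filter_upwards [eventually_gt_atTop 0] with x hx
    rw [← Real.rpow_add hx]
    norm_num
  have hlog4 : 0 < Real.log 4 := Real.log_pos (by norm_num)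
  have hev := hO.def (show (0 : ℝ) < Real.log 4 / 12 by positivity)
  obtain ⟨x₀, hx₀⟩ := eventually_atTop.1 hev
  obtain ⟨n₀, hn₀⟩ := exists_nat_ge (max x₀ 4)
  have hn₀4 : (4 : ℝ) ≤ n₀ := (le_max_right _ _).trans hn₀
  have hlog2 : 0 < Real.log 2 := Real.log_pos (by norm_num)
  -- For large n the term (1 + √(2n)) log(2n) uses up half of (n/3) log 4. For n < n₀ a single prime
  -- from Bertrand's postulate suffices.
  refine ⟨min (Real.log 4 / 6) (Real.log 2 / n₀), lt_min (by positivity) (by positivity), ?_⟩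
  intro n hn
  have hnR : (1 : ℝ) ≤ n := by exact_mod_cast hn
  by_cases h : n₀ ≤ n
  · have hnn : (n₀ : ℝ) ≤ n := by exact_mod_cast h
    have h4 : 4 ≤ n := by exact_mod_cast hn₀4.trans hnn
    have h1 := Nat.log_le_card_primes_Ioc_mul_log n h4
    have h2 := hx₀ (2 * n) (by linarith [le_max_left x₀ 4])
    have h3 := (le_abs_self _).trans h2
    rw [Real.norm_of_nonneg (by positivity)] at h3
    have h5 : min (Real.log 4 / 6) (Real.log 2 / n₀) * n ≤ Real.log 4 / 6 * n := by
      gcongr; exact min_le_left _ _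
    nlinarith
  · have hnn : (n : ℝ) ≤ n₀ := by exact_mod_cast (not_le.1 h).le
    obtain ⟨p, hp, hp1, hp2⟩ := Nat.exists_prime_lt_and_le_two_mul n (by omega)
    have hcard : (1 : ℝ) ≤ (((Finset.Ioc n (2 * n)).filter Nat.Prime).card : ℝ) := by
      have : 0 < ((Finset.Ioc n (2 * n)).filter Nat.Prime).card :=
        Finset.card_pos.2 ⟨p, by simp [hp, hp1, hp2]⟩
      exact_mod_cast this
    calc min (Real.log 4 / 6) (Real.log 2 / n₀) * n ≤ Real.log 2 / n₀ * n₀ := by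
          gcongr; exact min_le_right _ _
      _ = 1 * Real.log 2 := by field_simp
      _ ≤ _ := by gcongr; linarith

/-- Chebyshev's lower bound for the number of primes in `(⌈M/2⌉, M]`. -/
theorem exists_le_card_upperPrimes_mul_log :
    ∃ c : ℝ, 0 < c ∧ ∀ M : ℕ, 2 ≤ M → c * M ≤ ((upperPrimes M).card : ℝ) * Real.log M := by
  obtain ⟨c, hc, h⟩ := exists_le_card_primes_Ioc_mul_log
  refine ⟨c / 4, by positivity, fun M hM => ?_⟩
  have hMR : (2 : ℝ) ≤ M := by exact_mod_cast hM
  set n := (M + 1) / 2 with hn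
  have h1 := h n (by omega)
  have hsub : (Finset.Ioc n (2 * n)).filter Nat.Prime ⊆ upperPrimes M := by
    intro p hp
    simp only [upperPrimes, Finset.mem_filter, Finset.mem_Ioc] at hp ⊢
    refine ⟨⟨hp.1.1, ?_⟩, hp.2⟩
    -- For odd M the interval reaches 2n = M + 1, which is even and exceeds 2, hence not prime.
    rcases hp.2.eq_two_or_odd with h2 | h2 <;> omega
  have hcard : (((Finset.Ioc n (2 * n)).filter Nat.Prime).card : ℝ) ≤ (upperPrimes M).card := by
    exact_mod_cast Finset.card_le_card hsub
  have h2n : (2 * n : ℝ) ≤ (M : ℝ) ^ 2 := by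
    have : 2 * n ≤ M ^ 2 := by nlinarith [Nat.div_mul_le_self (M + 1) 2]
    exact_mod_cast this
  have hn1 : (1 : ℝ) ≤ n := by exact_mod_cast (by omega : 1 ≤ n)
  have hlog : Real.log (2 * n) ≤ 2 * Real.log M := by
    have := Real.log_le_log (by positivity) h2n
    rwa [Real.log_pow] at this
  have hM2 : (M : ℝ) ≤ 2 * n := by exact_mod_cast (by omega : M ≤ 2 * n)
  have hl : 0 ≤ Real.log (2 * n) := Real.log_nonneg (by linarith)
  have h3 := mul_le_mul hcard hlog hl (by positivity)
  nlinarith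

/-! ### Fourier modes and Parseval's identity on the cube -/

theorem fourierMode_add {d : ℕ} (k l : Fin d → ℤ) (x : Fin d → ℝ) :
    fourierMode (k + l) x = fourierMode k x * fourierMode l x := by
  simp only [fourierMode, ← Complex.exp_add]
  congr 1
  push_cast
  simp only [Pi.add_apply, Int.cast_add, add_mul, Finset.sum_add_distrib]
  ring

theorem fourierMode_apply_add {d : ℕ} (k : Fin d → ℤ) (x y : Fin d → ℝ) :
    fourierMode k (x + y) = fourierMode k x * fourierMode k y := by
  simp only [fourierMode, ← Complex.exp_add]
  congr 1
  push_cast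
  simp only [Pi.add_apply, Complex.ofReal_add, mul_add, Finset.sum_add_distrib]

theorem fourierMode_zero {d : ℕ} (x : Fin d → ℝ) : fourierMode 0 x = 1 := by
  simp [fourierMode]

theorem norm_fourierMode {d : ℕ} (k : Fin d → ℤ) (x : Fin d → ℝ) : ‖fourierMode k x‖ = 1 := by
  rw [fourierMode, Complex.norm_exp]
  simp

theorem conj_fourierMode {d : ℕ} (k : Fin d → ℤ) (x : Fin d → ℝ) :
    (starRingEnd ℂ) (fourierMode k x) = fourierMode (-k) x := by
  rw [fourierMode, fourierMode, ← Complex.exp_conj]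
  congr 1
  simp only [map_mul, Complex.conj_ofReal, Complex.conj_I, map_ofNat, Pi.neg_apply, Int.cast_neg,
    neg_mul, Finset.sum_neg_distrib, Complex.ofReal_neg]
  ring

theorem continuous_fourierMode {d : ℕ} (k : Fin d → ℤ) : Continuous (fourierMode k) := by
  unfold fourierMode
  fun_prop

theorem fourierMode_eq_prod {d : ℕ} (k : Fin d → ℤ) (x : Fin d → ℝ) :
    fourierMode k x = ∏ j, Complex.exp (2 * Real.pi * Complex.I * (k j : ℂ) * (x j : ℂ)) := by
  rw [fourierMode, ← Complex.exp_sum]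
  congr 1
  push_cast
  rw [Finset.mul_sum]
  exact Finset.sum_congr rfl fun j _ => by ring

theorem fourierMode_intCast {d : ℕ} (k : Fin d → ℤ) (m : Fin d → ℤ) :
    fourierMode k (fun j => (m j : ℝ)) = 1 := by
  rw [fourierMode, Complex.exp_eq_one_iff]
  refine ⟨∑ j, k j * m j, ?_⟩
  push_cast
  ring

theorem fourierMode_fract {d : ℕ} (k : Fin d → ℤ) (x : Fin d → ℝ) :
    fourierMode k (fun j => Int.fract (x j)) = fourierMode k x := by
  have h : x = (fun j => Int.fract (x j)) + fun j => ((⌊x j⌋ : ℤ) : ℝ) := by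
    ext j
    exact (Int.fract_add_floor (x j)).symm
  conv_rhs => rw [h]
  rw [fourierMode_apply_add, fourierMode_intCast, mul_one]

instance isProbabilityMeasure_unitCube (d : ℕ) :
    IsProbabilityMeasure ((volume : Measure (Fin d → ℝ)).restrict (unitCube d)) := by
  constructor
  rw [Measure.restrict_apply_univ, unitCube, Real.volume_Icc_pi]
  simp

theorem integral_Icc_exp_two_pi_mul_int (m : ℤ) :
    ∫ x in Set.Icc (0 : ℝ) 1, Complex.exp (2 * Real.pi * Complex.I * (m : ℂ) * (x : ℂ)) =
      if m = 0 then 1 else 0 := by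
  rw [integral_Icc_eq_integral_Ioc, ← intervalIntegral.integral_of_le zero_le_one]
  split_ifs with h
  · simp [h]
  · have hc : (2 * Real.pi * Complex.I * (m : ℂ)) ≠ 0 := by
      simp [Real.pi_ne_zero, h]
    rw [integral_exp_mul_complex hc]
    have : Complex.exp (2 * Real.pi * Complex.I * (m : ℂ) * ((1 : ℝ) : ℂ)) = 1 := by
      rw [Complex.exp_eq_one_iff]
      exact ⟨m, by push_cast; ring⟩
    rw [this]
    simp

theorem integral_fourierMode {d : ℕ} (k : Fin d → ℤ) :
    ∫ x in unitCube d, fourierMode k x = if k = 0 then 1 else 0 := by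
  simp only [fourierMode_eq_prod]
  rw [unitCube, ← Set.pi_univ_Icc, volume_pi, Measure.restrict_pi_pi,
    integral_fintype_prod_eq_prod (𝕜 := ℂ)
      (fun j (t : ℝ) => Complex.exp (2 * Real.pi * Complex.I * (k j : ℂ) * (t : ℂ)))]
  simp only [Pi.zero_apply, Pi.one_apply, integral_Icc_exp_two_pi_mul_int]
  rw [Finset.prod_ite_zero]
  simp [funext_iff]

theorem cubeFourierCoeff_zero {d : ℕ} (f : (Fin d → ℝ) → ℝ) :
    cubeFourierCoeff f 0 = (cubeIntegral f : ℂ) := by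
  simp only [cubeFourierCoeff, neg_zero, fourierMode_zero, mul_one, cubeIntegral]
  exact integral_ofReal

/-- **Parseval's identity** for absolutely convergent Fourier series on the cube. -/
theorem lintegral_enorm_tsum_fourierMode_sq {d : ℕ} (c : (Fin d → ℤ) → ℂ)
    (hc : Summable fun k => ‖c k‖) :
    ∫⁻ x in unitCube d, ‖∑' k, c k * fourierMode k x‖ₑ ^ 2 = ∑' k, ‖c k‖ₑ ^ 2 := by
  set g : (Fin d → ℝ) → ℂ := fun x => ∑' k, c k * fourierMode k x with hg
  have hterm : ∀ x, Summable fun k => ‖c k * fourierMode k x‖ := fun x => by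
    simpa only [norm_mul, norm_fourierMode, mul_one] using hc
  have hgc : Continuous g := continuous_tsum
    (fun k => continuous_const.mul (continuous_fourierMode k)) hc
    (fun k x => by rw [norm_mul, norm_fourierMode, mul_one])
  -- Expand |g|² as an absolutely convergent double series. Integrated termwise, only the diagonal
  -- survives by orthogonality.
  set F : (Fin d → ℤ) × (Fin d → ℤ) → (Fin d → ℝ) → ℂ := fun p x =>
    (c p.1 * fourierMode p.1 x) * (starRingEnd ℂ) (c p.2 * fourierMode p.2 x) with hF
  have hFnorm : ∀ p x, ‖F p x‖ = ‖c p.1‖ * ‖c p.2‖ := fun p x => by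
    simp only [hF, norm_mul, RCLike.norm_conj, norm_fourierMode, mul_one]
  have hFcont : ∀ p, Continuous (F p) := fun p =>
    (continuous_const.mul (continuous_fourierMode p.1)).mul
      (Complex.continuous_conj.comp (continuous_const.mul (continuous_fourierMode p.2)))
  have hFint : ∀ p, Integrable (F p) (volume.restrict (unitCube d)) := fun p =>
    (hFcont p).continuousOn.integrableOn_compact isCompact_Icc
  have hsum : Summable fun p => ∫ x in unitCube d, ‖F p x‖ := by
    simp only [hFnorm, integral_const, probReal_univ, one_smul]
    exact hc.mul_of_nonneg hc (fun _ => norm_nonneg _) fun _ => norm_nonneg _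
  have hI := (hasSum_integral_of_summable_integral_norm hFint hsum).tsum_eq
  have hgF : ∀ x, ∑' p, F p x = ((‖g x‖ ^ 2 : ℝ) : ℂ) := fun x => by
    have h1 : Summable fun k => c k * fourierMode k x := (hterm x).of_norm
    have h2 : Summable fun k => ‖(starRingEnd ℂ) (c k * fourierMode k x)‖ := by
      simpa only [RCLike.norm_conj] using hterm x
    have := tsum_mul_tsum_of_summable_norm (hterm x) h2
    rw [← Complex.conj_tsum, Complex.mul_conj, Complex.normSq_eq_norm_sq] at this
    exact this.symm
  have hval : ∀ p : (Fin d → ℤ) × (Fin d → ℤ), ∫ x in unitCube d, F p x =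
      if p.1 = p.2 then ((‖c p.1‖ ^ 2 : ℝ) : ℂ) else 0 := fun p => by
    have : ∀ x, F p x = (c p.1 * (starRingEnd ℂ) (c p.2)) * fourierMode (p.1 - p.2) x :=
      fun x => by
        rw [sub_eq_add_neg, fourierMode_add, ← conj_fourierMode]
        simp only [hF, map_mul]
        ring
    simp only [this]
    rw [integral_const_mul, integral_fourierMode]
    by_cases h : p.1 = p.2
    · rw [if_pos h, ← h, sub_self, if_pos rfl, mul_one, Complex.mul_conj,
        Complex.normSq_eq_norm_sq]
    · rw [if_neg h, if_neg (sub_ne_zero.2 h), mul_zero]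
  have hdiag : ∑' p, ∫ x in unitCube d, F p x = ∑' k, ((‖c k‖ ^ 2 : ℝ) : ℂ) := by
    simp only [hval]
    have hinj : Function.Injective fun k : Fin d → ℤ => (k, k) := fun a b h => (Prod.ext_iff.1 h).1
    rw [← hinj.tsum_eq]
    · simp
    · intro p hp
      have : p.1 = p.2 := by
        by_contra h
        simp [h] at hp
      exact ⟨p.1, Prod.ext rfl this⟩
  rw [hdiag] at hI
  simp only [hgF] at hI
  rw [integral_complex_ofReal, ← Complex.ofReal_tsum] at hI
  have hI' := Complex.ofReal_injective hI
  have hcs : Summable fun k => ‖c k‖ ^ 2 := by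
    have := (hc.mul_of_nonneg hc (fun _ => norm_nonneg _) fun _ => norm_nonneg _)
    have h2 := this.comp_injective (i := fun k : Fin d → ℤ => (k, k))
      (fun a b h => (Prod.ext_iff.1 h).1)
    refine h2.congr fun k => ?_
    simp [sq]
  have hgi : Integrable (fun x => ‖g x‖ ^ 2) (volume.restrict (unitCube d)) :=
    (hgc.norm.pow 2).continuousOn.integrableOn_compact isCompact_Icc
  have hconv : ∀ w : ℂ, ‖w‖ₑ ^ 2 = ENNReal.ofReal (‖w‖ ^ 2) := fun w => by
    rw [ENNReal.ofReal_pow (norm_nonneg _), ofReal_norm]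
  simp only [hconv]
  rw [← ofReal_integral_eq_lintegral_ofReal hgi (Filter.Eventually.of_forall fun x => by positivity),
    ← ENNReal.ofReal_tsum_of_nonneg (fun k => by positivity) hcs, ← hI']

/-! ### The error of a shifted lattice rule as a Fourier series -/

/-- Membership of `k` in the dual lattice of the rank-1 lattice generated by `z` modulo `N`. -/
def InDualLattice {d : ℕ} (N : ℕ) (z : Fin d → ℕ) (k : Fin d → ℤ) : Prop :=
  (N : ℤ) ∣ ∑ j, k j * (z j : ℤ)

/-- The `n`-th point of the rank-1 lattice generated by `z` modulo `N`, shifted by `Δ`. -/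
noncomputable def shiftedLatticePoint {d : ℕ} (N : ℕ) (z : Fin d → ℕ) (Δ : Fin d → ℝ) (n : ℕ) :
    Fin d → ℝ :=
  fun j => Int.fract ((n : ℝ) * (z j : ℝ) / (N : ℝ) + Δ j)

theorem latticePoints_eq_image {d : ℕ} (N : ℕ) (z : Fin d → ℕ) :
    latticePoints N z = (Finset.range N).image (shiftedLatticePoint N z 0) := by
  rw [latticePoints]
  refine Finset.image_congr fun n _ => ?_
  ext j
  simp [shiftedLatticePoint]

theorem shiftPoints_latticePoints_eq_image {d : ℕ} (N : ℕ) (z : Fin d → ℕ) (Δ : Fin d → ℝ) :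
    shiftPoints Δ (latticePoints N z) =
      (Finset.range N).image (shiftedLatticePoint N z Δ) := by
  rw [shiftPoints, latticePoints, Finset.image_image]
  refine Finset.image_congr fun n _ => ?_
  ext j
  simp only [Function.comp_apply, shiftedLatticePoint]
  rw [Int.fract_eq_fract]
  refine ⟨-⌊(n : ℝ) * (z j : ℝ) / (N : ℝ)⌋, ?_⟩
  push_cast
  linarith [Int.fract_add_floor ((n : ℝ) * (z j : ℝ) / (N : ℝ))]

theorem shiftedLatticePoint_mem_unitCube {d : ℕ} (N : ℕ) (z : Fin d → ℕ) (Δ : Fin d → ℝ) (n : ℕ) :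
    shiftedLatticePoint N z Δ n ∈ unitCube d :=
  ⟨fun _ => Int.fract_nonneg _, fun _ => (Int.fract_lt_one _).le⟩

/-- One coordinate already separates the points, because z_i is invertible modulo the prime N. -/
theorem injOn_shiftedLatticePoint {d N : ℕ} (hN : N.Prime) {z : Fin d → ℕ}
    (hz : z ∈ genVectors d N) (Δ : Fin d → ℝ) (i : Fin d) :
    Set.InjOn (shiftedLatticePoint N z Δ) (Finset.range N) := by
  intro n hn m hm h
  have hn' : n < N := by simpa using hn
  have hm' : m < N := by simpa using hm
  have hN0 : (N : ℝ) ≠ 0 := by exact_mod_cast hN.ne_zero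
  have h1 := congrFun h i
  simp only [shiftedLatticePoint] at h1
  obtain ⟨t, ht⟩ := Int.fract_eq_fract.1 h1
  have h2 : ((n : ℤ) - m) * (z i : ℤ) = N * t := by
    have : ((n : ℝ) - m) * (z i : ℝ) = N * t := by
      field_simp at ht
      linarith
    exact_mod_cast this
  have h3 : (N : ℤ) ∣ ((n : ℤ) - m) * (z i : ℤ) := ⟨t, h2⟩
  have hzi := Finset.mem_Icc.1 (Fintype.mem_piFinset.1 hz i)
  have h4 : (N : ℤ) ∣ (n : ℤ) - m := by
    refine ((Nat.prime_iff_prime_int.1 hN).dvd_or_dvd h3).resolve_right fun h5 => ?_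
    have := Nat.le_of_dvd (by omega) (Int.natCast_dvd_natCast.1 h5)
    have := hN.two_le
    omega
  have h5 := Int.eq_zero_of_abs_lt_dvd h4 (by rw [abs_lt]; omega)
  omega

theorem qmcRule_image_shiftedLatticePoint {d N : ℕ} (hN : N.Prime) {z : Fin d → ℕ}
    (hz : z ∈ genVectors d N) (Δ : Fin d → ℝ) (f : (Fin d → ℝ) → ℝ) :
    qmcRule ((Finset.range N).image (shiftedLatticePoint N z Δ)) f =
      1 / (N : ℝ) * ∑ n ∈ Finset.range N, f (shiftedLatticePoint N z Δ n) := by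
  -- In dimension 0 all N points coincide and the image has one element, but both averages still
  -- agree.
  rcases Nat.eq_zero_or_pos d with rfl | hd
  · have hN0 : (N : ℝ) ≠ 0 := by exact_mod_cast hN.ne_zero
    have h1 : (Finset.range N).image (shiftedLatticePoint N z Δ) = {0} := by
      ext x
      rw [Subsingleton.elim x 0]
      simp only [Finset.mem_image, Finset.mem_range, Finset.mem_singleton, iff_true]
      exact ⟨0, hN.pos, Subsingleton.elim _ _⟩
    rw [h1, qmcRule]
    simp only [Subsingleton.elim (shiftedLatticePoint N z Δ _) 0]
    simp [hN0]
  · have hinj := injOn_shiftedLatticePoint hN hz Δ ⟨0, hd⟩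
    rw [qmcRule, Finset.card_image_of_injOn hinj, Finset.card_range, Finset.sum_image hinj]

theorem fourierMode_shiftedLatticePoint {d N : ℕ} (z : Fin d → ℕ) (Δ : Fin d → ℝ) (n : ℕ)
    (k : Fin d → ℤ) :
    fourierMode k (shiftedLatticePoint N z Δ n) =
      Complex.exp (2 * Real.pi * Complex.I * ((∑ j, k j * (z j : ℤ) : ℤ) : ℂ) / N) ^ n *
        fourierMode k Δ := by
  have h : shiftedLatticePoint N z Δ n =
      fun j => Int.fract (((fun j => (n : ℝ) * (z j : ℝ) / (N : ℝ)) + Δ) j) := rfl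
  rw [h, fourierMode_fract, fourierMode_apply_add, ← Complex.exp_nat_mul, fourierMode]
  congr 2
  push_cast
  rw [Finset.mul_sum, Finset.mul_sum, Finset.sum_div, Finset.mul_sum]
  exact Finset.sum_congr rfl fun j _ => by ring

open scoped Classical in
-- A geometric sum over the powers of an N-th root of unity, which equals 1 exactly when k is dual.
theorem average_fourierMode_shiftedLatticePoint {d N : ℕ} (hN : 0 < N) (z : Fin d → ℕ)
    (Δ : Fin d → ℝ) (k : Fin d → ℤ) :
    1 / (N : ℂ) * ∑ n ∈ Finset.range N, fourierMode k (shiftedLatticePoint N z Δ n) =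
      (if InDualLattice N z k then 1 else 0) * fourierMode k Δ := by
  have hN0 : (N : ℂ) ≠ 0 := by exact_mod_cast hN.ne'
  simp only [fourierMode_shiftedLatticePoint, ← Finset.sum_mul]
  rw [← mul_assoc]
  congr 1
  set m : ℤ := ∑ j, k j * (z j : ℤ) with hm
  split_ifs with h
  · obtain ⟨t, ht⟩ : (N : ℤ) ∣ m := h
    have : Complex.exp (2 * Real.pi * Complex.I * (m : ℂ) / N) = 1 := by
      rw [Complex.exp_eq_one_iff]
      refine ⟨t, ?_⟩
      rw [ht]
      push_cast
      field_simp
    simp [this, hN0]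
  · set ω := Complex.exp (2 * Real.pi * Complex.I * (m : ℂ) / N) with hω
    have h1 : ω ≠ 1 := by
      intro h2
      obtain ⟨t, ht⟩ := Complex.exp_eq_one_iff.1 h2
      apply h
      refine ⟨t, ?_⟩
      have hpi : (2 * Real.pi * Complex.I : ℂ) ≠ 0 := Complex.two_pi_I_ne_zero
      have h3 : (2 * Real.pi * Complex.I : ℂ) * m = (2 * Real.pi * Complex.I : ℂ) * (N * t) := by
        field_simp at ht
        linear_combination (2 * Real.pi * Complex.I : ℂ) * ht
      have h4 := mul_left_cancel₀ hpi h3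
      exact_mod_cast h4
    have h2 : ω ^ N = 1 := by
      rw [hω, ← Complex.exp_nat_mul, Complex.exp_eq_one_iff]
      exact ⟨m, by field_simp⟩
    rw [geom_sum_eq h1, h2]
    simp

open scoped Classical in
/-- The Fourier coefficients of the error of a lattice rule. -/
noncomputable def errorCoeff {d : ℕ} (N : ℕ) (z : Fin d → ℕ) (f : (Fin d → ℝ) → ℝ)
    (k : Fin d → ℤ) : ℂ :=
  if k ≠ 0 ∧ InDualLattice N z k then cubeFourierCoeff f k else 0

theorem summable_norm_errorCoeff {d : ℕ} {α : ℝ} {γ : ℕ → ℝ≥0} {f : (Fin d → ℝ) → ℝ}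
    (hf : MemKorobov α γ f) (N : ℕ) (z : Fin d → ℕ) :
    Summable fun k => ‖errorCoeff N z f k‖ := by
  refine Summable.of_nonneg_of_le (fun _ => norm_nonneg _) (fun k => ?_) hf.summable_coeff
  unfold errorCoeff
  split_ifs
  · exact le_rfl
  · simp

theorem hasSum_errorCoeff {d N : ℕ} {α : ℝ} {γ : ℕ → ℝ≥0} {f : (Fin d → ℝ) → ℝ}
    (hf : MemKorobov α γ f) (hN : N.Prime) {z : Fin d → ℕ} (hz : z ∈ genVectors d N)
    (Δ : Fin d → ℝ) :
    HasSum (fun k => errorCoeff N z f k * fourierMode k Δ)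
      ((qmcRule ((Finset.range N).image (shiftedLatticePoint N z Δ)) f - cubeIntegral f : ℝ) : ℂ) := by
  classical
  have h1 := hasSum_sum (s := Finset.range N) fun n _ =>
    hf.hasSum_fourier _ (shiftedLatticePoint_mem_unitCube N z Δ n)
  have h2 := h1.mul_left (1 / (N : ℂ))
  have h3 := h2.sub (hasSum_ite_eq (0 : Fin d → ℤ) (cubeIntegral f : ℂ))
  rw [qmcRule_image_shiftedLatticePoint hN hz]
  push_cast
  suffices h : (fun k => errorCoeff N z f k * fourierMode k Δ) = _ by
    rw [h]
    exact h3
  funext k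
  have h4 := average_fourierMode_shiftedLatticePoint hN.pos z Δ k
  rw [← Finset.mul_sum, mul_left_comm, h4, errorCoeff]
  by_cases hk : k = 0
  · subst hk
    simp [InDualLattice, fourierMode_zero, cubeFourierCoeff_zero]
  · by_cases h : InDualLattice N z k <;> simp [hk, h]

/-! ### Upper bound for the worst-case error, and the mean square over the shift -/

theorem tsum_enorm_sq_mul_korobovWeight_sq_le_one {d : ℕ} {α : ℝ} {γ : ℕ → ℝ≥0}
    {f : (Fin d → ℝ) → ℝ} (hf : f ∈ korobovUnitBall d α γ) :
    ∑' k : Fin d → ℤ, ‖cubeFourierCoeff f k‖ₑ ^ 2 * korobovWeight α γ k ^ 2 ≤ 1 := by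
  have h := hf.2
  rw [korobovNorm] at h
  by_contra h1
  have h2 := ENNReal.one_lt_rpow (not_le.1 h1) (show (0 : ℝ) < 1 / 2 by norm_num)
  exact absurd h (not_le.2 h2)

theorem one_le_korobovWeight {d : ℕ} {α : ℝ} (hα : 0 ≤ α) {γ : ℕ → ℝ≥0} (hγ : ∀ j, γ j ≤ 1)
    (k : Fin d → ℤ) : 1 ≤ korobovWeight α γ k := by
  refine Finset.one_le_prod' fun j hj => ?_
  have hk : k j ≠ 0 := (Finset.mem_filter.1 hj).2
  have h1 : (1 : ℝ) ≤ |(k j : ℝ)| := by exact_mod_cast Int.one_le_abs hk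
  have h2 : (1 : ℝ≥0∞) ≤ ENNReal.ofReal (|(k j : ℝ)| ^ α) :=
    ENNReal.one_le_ofReal.2 (Real.one_le_rpow h1 hα)
  refine h2.trans ?_
  calc ENNReal.ofReal (|(k j : ℝ)| ^ α) = ENNReal.ofReal (|(k j : ℝ)| ^ α) / 1 := by simp
    _ ≤ _ := ENNReal.div_le_div_left (by exact_mod_cast hγ j) _

theorem korobovWeight_neg {d : ℕ} (α : ℝ) (γ : ℕ → ℝ≥0) (k : Fin d → ℤ) :
    korobovWeight α γ (-k) = korobovWeight α γ k := by
  simp [korobovWeight]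

theorem ENNReal.tsum_mul_le_rpow_mul_rpow {ι : Type*} (f g : ι → ℝ≥0∞) :
    ∑' i, f i * g i ≤ (∑' i, f i ^ 2) ^ (1 / 2 : ℝ) * (∑' i, g i ^ 2) ^ (1 / 2 : ℝ) := by
  let _ : MeasurableSpace ι := ⊤
  have h := ENNReal.lintegral_mul_le_Lp_mul_Lq (Measure.count (α := ι))
    Real.HolderConjugate.two_two (f := f) (g := g) (measurable_from_top).aemeasurable
    (measurable_from_top).aemeasurable
  simpa [lintegral_count] using h

open scoped Classical in
-- Cauchy–Schwarz, pairing |f̂(k)| r(k) with 1/r(k) over the nonzero dual lattice.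
theorem worstCaseError_latticePoints_le {d N : ℕ} {α : ℝ} (hα : 0 ≤ α) {γ : ℕ → ℝ≥0}
    (hγ : ∀ j, γ j ≤ 1) (hN : N.Prime) {z : Fin d → ℕ} (hz : z ∈ genVectors d N) :
    worstCaseError α γ (qmcRule (latticePoints N z)) ≤
      (∑' k : Fin d → ℤ, if k ≠ 0 ∧ InDualLattice N z k then (korobovWeight α γ k)⁻¹ ^ 2 else 0) ^
        (1 / 2 : ℝ) := by
  refine iSup₂_le fun f hf => ?_
  have h1 := hasSum_errorCoeff hf.1 hN hz 0
  have hs := summable_norm_errorCoeff hf.1 N z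
  rw [← latticePoints_eq_image] at h1
  have hle := tsum_enorm_sq_mul_korobovWeight_sq_le_one hf
  calc ENNReal.ofReal |cubeIntegral f - qmcRule (latticePoints N z) f|
      = ‖∑' k, errorCoeff N z f k * fourierMode k 0‖ₑ := by
        rw [h1.tsum_eq, ← ofReal_norm, Complex.norm_real, Real.norm_eq_abs, abs_sub_comm]
    _ ≤ ∑' k, ‖errorCoeff N z f k * fourierMode k 0‖ₑ := enorm_tsum_le_tsum_enorm
    _ ≤ ∑' k, (‖cubeFourierCoeff f k‖ₑ * korobovWeight α γ k) *
          (if k ≠ 0 ∧ InDualLattice N z k then (korobovWeight α γ k)⁻¹ else 0) := by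
        refine ENNReal.tsum_le_tsum fun k => ?_
        have : ‖fourierMode k (0 : Fin d → ℝ)‖ₑ = 1 := by
          rw [← ofReal_norm, norm_fourierMode, ENNReal.ofReal_one]
        rw [enorm_mul, this, mul_one, errorCoeff]
        split_ifs with h
        -- Where r(k) = ∞ the product r(k) · r(k)⁻¹ is 0, not 1; finiteness of the norm forces f̂(k)
        -- = 0 there.
        · by_cases hw : korobovWeight α γ k = ∞
          · have h2 := (ENNReal.le_tsum k).trans hle
            rw [hw] at h2
            by_cases h3 : ‖cubeFourierCoeff f k‖ₑ = 0
            · simp [h3]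
            · rw [ENNReal.top_pow two_ne_zero, ENNReal.mul_top (pow_ne_zero 2 h3)] at h2
              exact absurd h2 (by simp)
          · have hw0 : korobovWeight α γ k ≠ 0 :=
              (zero_lt_one.trans_le (one_le_korobovWeight hα hγ k)).ne'
            rw [mul_assoc, ENNReal.mul_inv_cancel hw0 hw, mul_one]
        · simp
    _ ≤ _ := ENNReal.tsum_mul_le_rpow_mul_rpow _ _
    _ ≤ 1 * _ := by
        refine mul_le_mul' ?_ (le_of_eq ?_)
        · simp only [mul_pow]
          calc _ ≤ (1 : ℝ≥0∞) ^ (1 / 2 : ℝ) := ENNReal.rpow_le_rpow hle (by norm_num)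
            _ = 1 := ENNReal.one_rpow _
        · congr 2
          funext k
          split_ifs <;> simp
    _ = _ := one_mul _

theorem lintegral_shiftPoints_eq {d N : ℕ} {α : ℝ} {γ : ℕ → ℝ≥0} {f : (Fin d → ℝ) → ℝ}
    (hf : MemKorobov α γ f) (hN : N.Prime) {z : Fin d → ℕ} (hz : z ∈ genVectors d N) :
    ∫⁻ Δ in unitCube d, ENNReal.ofReal
        (|cubeIntegral f - qmcRule (shiftPoints Δ (latticePoints N z)) f| ^ 2) =
      ∑' k, ‖errorCoeff N z f k‖ₑ ^ 2 := by
  rw [← lintegral_enorm_tsum_fourierMode_sq _ (summable_norm_errorCoeff hf N z)]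
  refine lintegral_congr fun Δ => ?_
  rw [(hasSum_errorCoeff hf hN hz Δ).tsum_eq, shiftPoints_latticePoints_eq_image, ← ofReal_norm,
    ← ENNReal.ofReal_pow (norm_nonneg _), Complex.norm_real, Real.norm_eq_abs, abs_sub_comm]

/-! ### Lower bound for the worst-case error by cosine test functions -/

/-- The function `x ↦ c cos (2 π k·x)`. -/
noncomputable def cosMode {d : ℕ} (c : ℝ) (k : Fin d → ℤ) (x : Fin d → ℝ) : ℝ :=
  c * (fourierMode k x).re

theorem ofReal_cosMode {d : ℕ} (c : ℝ) (k : Fin d → ℤ) (x : Fin d → ℝ) :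
    (cosMode c k x : ℂ) = (c / 2 : ℂ) * fourierMode k x + (c / 2 : ℂ) * fourierMode (-k) x := by
  rw [cosMode, Complex.ofReal_mul, Complex.re_eq_add_conj, conj_fourierMode]
  ring

theorem continuous_cosMode {d : ℕ} (c : ℝ) (k : Fin d → ℤ) : Continuous (cosMode c k) :=
  continuous_const.mul (Complex.continuous_re.comp (continuous_fourierMode k))

theorem cubeFourierCoeff_cosMode {d : ℕ} (c : ℝ) (k l : Fin d → ℤ) :
    cubeFourierCoeff (cosMode c k) l =
      (if l = k then (c / 2 : ℂ) else 0) + if l = -k then (c / 2 : ℂ) else 0 := by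
  have h : ∀ x, (cosMode c k x : ℂ) * fourierMode (-l) x =
      (c / 2 : ℂ) * fourierMode (k - l) x + (c / 2 : ℂ) * fourierMode (-k - l) x := fun x => by
    rw [ofReal_cosMode, sub_eq_add_neg, sub_eq_add_neg, fourierMode_add, fourierMode_add]
    ring
  have hi : ∀ m : Fin d → ℤ, Integrable (fun x => (c / 2 : ℂ) * fourierMode m x)
      (volume.restrict (unitCube d)) := fun m =>
    (continuous_const.mul (continuous_fourierMode m)).continuousOn.integrableOn_compact isCompact_Icc
  simp only [cubeFourierCoeff, h]
  rw [integral_add (hi _) (hi _), integral_const_mul, integral_const_mul, integral_fourierMode,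
    integral_fourierMode]
  simp only [sub_eq_zero, eq_comm (a := l)]
  simp

theorem cubeFourierCoeff_cosMode_eq_zero {d : ℕ} (c : ℝ) {k l : Fin d → ℤ}
    (h : l ∉ ({k, -k} : Finset (Fin d → ℤ))) : cubeFourierCoeff (cosMode c k) l = 0 := by
  simp only [Finset.mem_insert, Finset.mem_singleton, not_or] at h
  simp [cubeFourierCoeff_cosMode, h.1, h.2]

theorem Pi.int_ne_neg_self {d : ℕ} {k : Fin d → ℤ} (hk : k ≠ 0) : k ≠ -k := fun h => by
  apply hk
  funext j
  have := congrFun h j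
  simp only [Pi.neg_apply, Pi.zero_apply] at this ⊢
  omega

theorem korobovNorm_cosMode_le {d : ℕ} {α : ℝ} {γ : ℕ → ℝ≥0} {k : Fin d → ℤ} (hk : k ≠ 0) {c : ℝ}
    (hc : 0 ≤ c) (hcw : ENNReal.ofReal c * korobovWeight α γ k ≤ 1) :
    korobovNorm α γ (cosMode c k) ≤ 1 := by
  have hkk := Pi.int_ne_neg_self hk
  have he : ‖(c / 2 : ℂ)‖ₑ ≤ ENNReal.ofReal c * (1 / 2) := by
    rw [← ofReal_norm]
    simp only [norm_div, Complex.norm_real, Real.norm_eq_abs, abs_of_nonneg hc]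
    rw [ENNReal.ofReal_div_of_pos (by norm_num)]
    simp [div_eq_mul_inv]
  have h2 : ∀ w, w = korobovWeight α γ k → ‖(c / 2 : ℂ)‖ₑ ^ 2 * w ^ 2 ≤ 1 / 2 := by
    rintro w rfl
    rw [← mul_pow]
    calc (‖(c / 2 : ℂ)‖ₑ * korobovWeight α γ k) ^ 2
        ≤ (ENNReal.ofReal c * (1 / 2) * korobovWeight α γ k) ^ 2 := by gcongr
      _ = (ENNReal.ofReal c * korobovWeight α γ k * (1 / 2)) ^ 2 := by ring
      _ ≤ (1 * (1 / 2)) ^ 2 := by gcongr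
      _ = 1 / 2 * (1 / 2) := by ring
      _ ≤ 1 / 2 * 1 := by gcongr; simp
      _ = 1 / 2 := mul_one _
  rw [korobovNorm, tsum_eq_sum (s := {k, -k}), Finset.sum_pair hkk]
  · refine (ENNReal.rpow_le_rpow (z := 1 / 2) (?_ : _ ≤ (1 : ℝ≥0∞)) (by norm_num)).trans_eq
      (ENNReal.one_rpow _)
    rw [cubeFourierCoeff_cosMode, cubeFourierCoeff_cosMode, if_pos rfl, if_neg hkk,
      if_neg hkk.symm, if_pos rfl, add_zero, zero_add]
    calc _ ≤ (1 / 2 + 1 / 2 : ℝ≥0∞) :=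
          add_le_add (h2 _ rfl) (h2 _ (korobovWeight_neg α γ k))
      _ = 1 := ENNReal.add_halves 1
  · intro l hl
    simp [cubeFourierCoeff_cosMode_eq_zero c hl]

theorem cosMode_mem_korobovUnitBall {d : ℕ} {α : ℝ} {γ : ℕ → ℝ≥0} {k : Fin d → ℤ} (hk : k ≠ 0)
    {c : ℝ} (hc : 0 ≤ c) (hcw : ENNReal.ofReal c * korobovWeight α γ k ≤ 1) :
    cosMode c k ∈ korobovUnitBall d α γ := by
  have hkk := Pi.int_ne_neg_self hk
  have hn := korobovNorm_cosMode_le hk hc hcw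
  refine ⟨⟨(continuous_cosMode c k).continuousOn.integrableOn_compact isCompact_Icc, ?_, ?_,
    hn.trans_lt ENNReal.one_lt_top⟩, hn⟩
  · exact summable_of_ne_finset_zero (s := {k, -k}) fun l hl => by
      rw [cubeFourierCoeff_cosMode_eq_zero c hl, norm_zero]
  · intro x _
    have h := hasSum_sum_of_ne_finset_zero (L := .unconditional _) (s := {k, -k})
      (f := fun l => cubeFourierCoeff (cosMode c k) l * fourierMode l x) fun l hl => by
        rw [cubeFourierCoeff_cosMode_eq_zero c hl, zero_mul]
    rw [Finset.sum_pair hkk, cubeFourierCoeff_cosMode, cubeFourierCoeff_cosMode, if_pos rfl,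
      if_neg hkk, if_neg hkk.symm, if_pos rfl, add_zero, zero_add] at h
    rwa [ofReal_cosMode]

/-- The test function c cos(2πk·x) with c = 1/r(k) has integral 0 and equals c at every lattice
point when k is dual. For r(k) = ∞ it is the zero function. -/
theorem inv_korobovWeight_le_worstCaseError {d N : ℕ} {α : ℝ} (hα : 0 ≤ α) {γ : ℕ → ℝ≥0}
    (hγ : ∀ j, γ j ≤ 1) (hN : N.Prime) {z : Fin d → ℕ} (hz : z ∈ genVectors d N) {k : Fin d → ℤ}
    (hk : k ≠ 0) (hd : InDualLattice N z k) :
    (korobovWeight α γ k)⁻¹ ≤ worstCaseError α γ (qmcRule (latticePoints N z)) := by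
  classical
  have hw1 := one_le_korobovWeight hα hγ k
  have hinv : (korobovWeight α γ k)⁻¹ ≠ ∞ := ENNReal.inv_ne_top.2 (zero_lt_one.trans_le hw1).ne'
  set c : ℝ := ((korobovWeight α γ k)⁻¹).toReal with hc
  have hc0 : 0 ≤ c := ENNReal.toReal_nonneg
  have hcof : ENNReal.ofReal c = (korobovWeight α γ k)⁻¹ := ENNReal.ofReal_toReal hinv
  have hcw : ENNReal.ofReal c * korobovWeight α γ k ≤ 1 := by
    rw [hcof]
    exact ENNReal.inv_mul_le_one _
  have hmem := cosMode_mem_korobovUnitBall hk hc0 hcw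
  refine le_trans ?_ (le_iSup₂ (cosMode c k) hmem)
  have hI : cubeIntegral (cosMode c k) = 0 := by
    have h := cubeFourierCoeff_zero (cosMode c k)
    rw [cubeFourierCoeff_cosMode, if_neg hk.symm,
      if_neg (by simpa [eq_comm] using hk), add_zero] at h
    exact_mod_cast h.symm
  have hN0 : (N : ℂ) ≠ 0 := by exact_mod_cast hN.ne_zero
  have hQ : ((qmcRule (latticePoints N z) (cosMode c k) : ℝ) : ℂ) = c := by
    have h1 := average_fourierMode_shiftedLatticePoint hN.pos z 0 k
    have h2 := average_fourierMode_shiftedLatticePoint hN.pos z 0 (-k)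
    have hd' : InDualLattice N z (-k) := by
      simpa [InDualLattice] using hd
    have h0 : ∀ l : Fin d → ℤ, fourierMode l 0 = 1 := fun l => by simp [fourierMode]
    rw [if_pos hd, h0, one_mul] at h1
    rw [if_pos hd', h0, one_mul] at h2
    rw [latticePoints_eq_image, qmcRule_image_shiftedLatticePoint hN hz]
    push_cast
    simp only [ofReal_cosMode, Finset.sum_add_distrib, ← Finset.mul_sum]
    linear_combination (c / 2 : ℂ) * h1 + (c / 2 : ℂ) * h2
  have hQ' : qmcRule (latticePoints N z) (cosMode c k) = c := by exact_mod_cast hQ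
  rw [hI, hQ', zero_sub, abs_neg, abs_of_nonneg hc0, hcof]

/-! ### Counting the generating vectors for which a frequency is dual -/

theorem card_genVectors (d N : ℕ) : (genVectors d N).card = (N - 1) ^ d := by
  simp [genVectors]

open scoped Classical in
-- If N does not divide k_i, the other coordinates of z determine z_i in a dual relation.
-- Overwriting z_i by an arbitrary value therefore loses no information.
theorem card_filter_inDualLattice_mul_le {d N : ℕ} (hN : N.Prime) {k : Fin d → ℤ} {i : Fin d}
    (hi : ¬ (N : ℤ) ∣ k i) :
    ((genVectors d N).filter fun z => InDualLattice N z k).card * (N - 1) ≤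
      (genVectors d N).card := by
  have hcard : N - 1 = (Finset.Icc 1 (N - 1)).card := by simp
  conv_lhs => rw [hcard]
  rw [← Finset.card_product]
  refine Finset.card_le_card_of_injOn (fun p => Function.update p.1 i p.2) ?_ ?_
  · intro p hp
    simp only [Finset.coe_product, Set.mem_prod, Finset.mem_coe, Finset.mem_filter] at hp
    simp only [Finset.mem_coe, genVectors, Fintype.mem_piFinset] at hp ⊢
    intro j
    by_cases hj : j = i
    · subst hj
      simpa using hp.2
    · simpa [Function.update_of_ne hj] using hp.1.1 j
  · rintro ⟨z, t⟩ hp ⟨z', t'⟩ hp' h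
    simp only [Finset.coe_product, Set.mem_prod, Finset.mem_coe, Finset.mem_filter] at hp hp'
    simp only at h
    have ht : t = t' := by simpa using congrFun h i
    have hz : ∀ j, j ≠ i → z j = z' j := fun j hj => by
      simpa [Function.update_of_ne hj] using congrFun h j
    have hd := dvd_sub hp.1.2 hp'.1.2
    rw [← Finset.sum_sub_distrib, Finset.sum_eq_single i
      (fun j _ hj => by rw [hz j hj, sub_self]) (by simp), ← mul_sub] at hd
    have h4 := ((Nat.prime_iff_prime_int.1 hN).dvd_or_dvd hd).resolve_left hi
    have hzi := Finset.mem_Icc.1 (Fintype.mem_piFinset.1 hp.1.1 i)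
    have hzi' := Finset.mem_Icc.1 (Fintype.mem_piFinset.1 hp'.1.1 i)
    have h5 := Int.eq_zero_of_abs_lt_dvd h4 (by rw [abs_lt]; omega)
    have hzz : z = z' := by
      funext j
      by_cases hj : j = i
      · subst hj; omega
      · exact hz j hj
    rw [hzz, ht]

/-! ### Sums of powers of 1/r(k) as products of zeta factors -/

theorem ENNReal.tsum_pi_prod {d : ℕ} {β : Type*} (g : Fin d → β → ℝ≥0∞) :
    ∑' k : Fin d → β, ∏ j, g j (k j) = ∏ j, ∑' m, g j m := by
  induction d with
  | zero => simp [tsum_fintype]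
  | succ d ih =>
    rw [← (Fin.consEquiv fun _ : Fin (d + 1) => β).tsum_eq, ENNReal.tsum_prod', Fin.prod_univ_succ,
      ← ih fun j => g j.succ, ← ENNReal.tsum_mul_right]
    refine tsum_congr fun a => ?_
    rw [← ENNReal.tsum_mul_left]
    refine tsum_congr fun b => ?_
    rw [Fin.prod_univ_succ]
    simp [Fin.consEquiv]

theorem ENNReal.rpow_tsum_le_tsum_rpow {ι : Type*} (f : ι → ℝ≥0∞) {p : ℝ} (hp : 0 < p)
    (hp1 : p ≤ 1) : (∑' i, f i) ^ p ≤ ∑' i, f i ^ p := by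
  rw [← ENNReal.le_rpow_inv_iff hp]
  refine ENNReal.summable.tsum_le_of_sum_le fun s => ?_
  rw [ENNReal.le_rpow_inv_iff hp]
  refine le_trans ?_ (ENNReal.sum_le_tsum s)
  classical
  induction s using Finset.induction_on with
  | empty => simp [hp]
  | insert a s ha ih =>
    rw [Finset.sum_insert ha, Finset.sum_insert ha]
    exact (ENNReal.rpow_add_le_add_rpow _ _ hp.le hp1).trans (add_le_add_right ih _)

theorem riemannZeta_re_eq_tsum {s : ℝ} (hs : 1 < s) :
    (riemannZeta (s : ℂ)).re = ∑' n : ℕ, ((n : ℝ) + 1) ^ (-s) := by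
  rw [zeta_eq_tsum_one_div_nat_add_one_cpow (by simpa using hs)]
  have : ∀ n : ℕ, 1 / ((n : ℂ) + 1) ^ (s : ℂ) = ((((n : ℝ) + 1) ^ (-s) : ℝ) : ℂ) := fun n => by
    rw [Real.rpow_neg (by positivity), Complex.ofReal_inv, Complex.ofReal_cpow (by positivity)]
    simp
  simp only [this]
  rw [← Complex.ofReal_tsum, Complex.ofReal_re]

theorem summable_nat_add_one_rpow_neg {s : ℝ} (hs : 1 < s) :
    Summable fun n : ℕ => ((n : ℝ) + 1) ^ (-s) := by
  have := (summable_nat_add_iff 1).2 (Real.summable_nat_rpow.2 (show -s < -1 by linarith))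
  simpa using this

theorem ENNReal.tsum_int_eq_add_two_mul (f : ℤ → ℝ≥0∞) (hf : ∀ m, f (-m) = f m) :
    ∑' m, f m = f 0 + 2 * ∑' n : ℕ, f ((n : ℤ) + 1) := by
  have h := (HasSum.of_nat_of_neg_add_one (f := f) ENNReal.summable.hasSum
    ENNReal.summable.hasSum).tsum_eq
  rw [h, tsum_eq_zero_add' ENNReal.summable]
  have : ∀ n : ℕ, f (-((n : ℤ) + 1)) = f ((n : ℤ) + 1) := fun n => hf _
  simp only [this, Nat.cast_add, Nat.cast_one, Nat.cast_zero]
  ring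

/-- The factor of `r(k)^(-1/lam)` belonging to one coordinate. -/
noncomputable def weightFactor (α lam : ℝ) (g : ℝ≥0) (m : ℤ) : ℝ≥0∞ :=
  if m = 0 then 1 else ENNReal.ofReal ((g : ℝ) ^ (1 / lam) * |(m : ℝ)| ^ (-(α / lam)))

theorem one_le_zetaFactor {α lam : ℝ} (hlam : 0 < lam) (h : lam < α) (γ : ℕ → ℝ≥0) (j : ℕ) :
    1 ≤ zetaFactor α γ lam j := by
  have hs : 1 < α / lam := (one_lt_div hlam).2 h
  rw [zetaFactor, riemannZeta_re_eq_tsum hs]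
  have : 0 ≤ ∑' n : ℕ, ((n : ℝ) + 1) ^ (-(α / lam)) := tsum_nonneg fun n => by positivity
  have h2 : 0 ≤ (γ j : ℝ) ^ (1 / lam) := by positivity
  nlinarith [mul_nonneg h2 this]

theorem tsum_weightFactor {α lam : ℝ} (hlam : 0 < lam) (h : lam < α) (γ : ℕ → ℝ≥0) (j : ℕ) :
    ∑' m, weightFactor α lam (γ j) m = ENNReal.ofReal (zetaFactor α γ lam j) := by
  have hs : 1 < α / lam := (one_lt_div hlam).2 h
  rw [ENNReal.tsum_int_eq_add_two_mul _ fun m => by simp [weightFactor], zetaFactor,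
    riemannZeta_re_eq_tsum hs]
  have hp : 0 ≤ ∑' n : ℕ, ((n : ℝ) + 1) ^ (-(α / lam)) := tsum_nonneg fun n => by positivity
  have hg : 0 ≤ (γ j : ℝ) ^ (1 / lam) := by positivity
  rw [ENNReal.ofReal_add zero_le_one (by positivity), ENNReal.ofReal_one]
  have h0 : weightFactor α lam (γ j) 0 = 1 := by simp [weightFactor]
  have h1 : ∀ n : ℕ, weightFactor α lam (γ j) ((n : ℤ) + 1) =
      ENNReal.ofReal ((γ j : ℝ) ^ (1 / lam)) * ENNReal.ofReal (((n : ℝ) + 1) ^ (-(α / lam))) :=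
    fun n => by
      rw [weightFactor, if_neg (by omega), ← ENNReal.ofReal_mul hg]
      push_cast
      rw [abs_of_nonneg (by positivity)]
  simp only [h0, h1]
  rw [ENNReal.tsum_mul_left, ← ENNReal.ofReal_tsum_of_nonneg (fun n => by positivity)
    (summable_nat_add_one_rpow_neg hs), mul_assoc, ENNReal.ofReal_mul zero_le_two,
    ENNReal.ofReal_mul hg]
  simp

theorem inv_korobovWeight_rpow_eq_prod {d : ℕ} {α lam : ℝ} (hlam : 0 < lam)
    (γ : ℕ → ℝ≥0) (k : Fin d → ℤ) :
    (korobovWeight α γ k)⁻¹ ^ (1 / lam) = ∏ j : Fin d, weightFactor α lam (γ j) (k j) := by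
  have hpos : ∀ j ∈ Finset.univ.filter (fun j : Fin d => k j ≠ 0), 0 < |(k j : ℝ)| := fun j hj => by
    have : k j ≠ 0 := (Finset.mem_filter.1 hj).2
    positivity
  have hne : ∀ j ∈ Finset.univ.filter (fun j : Fin d => k j ≠ 0),
      ENNReal.ofReal (|(k j : ℝ)| ^ α) / (γ j : ℝ≥0∞) ≠ 0 := fun j hj => by
    have := hpos j hj
    refine (ENNReal.div_pos ?_ ENNReal.coe_ne_top).ne'
    exact (ENNReal.ofReal_pos.2 (by positivity)).ne'
  rw [korobovWeight, ENNReal.prod_inv_distrib fun a ha b _ _ => Or.inl (hne a ha),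
    ← ENNReal.prod_rpow_of_nonneg (by positivity), Finset.prod_filter]
  refine Finset.prod_congr rfl fun j _ => ?_
  by_cases h : k j = 0
  · simp [weightFactor, h]
  · have hk : 0 < |(k j : ℝ)| := by positivity
    rw [if_pos h, weightFactor, if_neg h, ENNReal.inv_div (Or.inl ENNReal.coe_ne_top)
      (Or.inr (ENNReal.ofReal_pos.2 (by positivity)).ne'), div_eq_mul_inv,
      ENNReal.mul_rpow_of_nonneg _ _ (by positivity), ENNReal.ofReal_mul (by positivity),
      ← ENNReal.ofReal_inv_of_pos (by positivity), ENNReal.ofReal_rpow_of_pos (by positivity),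
      ← ENNReal.ofReal_coe_nnreal, ENNReal.ofReal_rpow_of_nonneg (by positivity) (by positivity),
      ← Real.rpow_neg hk.le, ← Real.rpow_mul hk.le]
    congr 3
    ring

theorem tsum_inv_korobovWeight_rpow {d : ℕ} {α lam : ℝ} (hlam : 0 < lam) (h : lam < α)
    (γ : ℕ → ℝ≥0) :
    ∑' k : Fin d → ℤ, (korobovWeight α γ k)⁻¹ ^ (1 / lam) =
      ENNReal.ofReal (∏ j : Fin d, zetaFactor α γ lam j) := by
  simp only [inv_korobovWeight_rpow_eq_prod hlam]
  rw [ENNReal.tsum_pi_prod fun j : Fin d => weightFactor α lam (γ j),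
    ENNReal.ofReal_prod_of_nonneg fun (j : Fin d) _ => zero_le_one.trans (one_le_zetaFactor hlam h γ j)]
  exact Finset.prod_congr rfl fun j _ => tsum_weightFactor hlam h γ j

theorem korobovWeight_nsmul_ge {d : ℕ} {α : ℝ} (hα : 0 ≤ α) (γ : ℕ → ℝ≥0) {k : Fin d → ℤ}
    (hk : k ≠ 0) {N : ℕ} (hN : 0 < N) :
    ENNReal.ofReal ((N : ℝ) ^ α) * korobovWeight α γ k ≤
      korobovWeight α γ (fun j => (N : ℤ) * k j) := by
  have hN1 : (1 : ℝ) ≤ N := by exact_mod_cast hN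
  obtain ⟨i, hi⟩ := Function.ne_iff.1 hk
  have h1 : 1 ≤ ENNReal.ofReal ((N : ℝ) ^ α) :=
    ENNReal.one_le_ofReal.2 (Real.one_le_rpow hN1 hα)
  have hfac : korobovWeight α γ (fun j => (N : ℤ) * k j) =
      ENNReal.ofReal ((N : ℝ) ^ α) ^ (Finset.univ.filter fun j => k j ≠ 0).card *
        korobovWeight α γ k := by
    simp only [korobovWeight]
    rw [← Finset.prod_const, ← Finset.prod_mul_distrib]
    refine Finset.prod_congr (by ext j; simp [hN.ne']) fun j _ => ?_
    push_cast
    rw [abs_mul, Nat.abs_cast, Real.mul_rpow (by positivity) (by positivity),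
      ENNReal.ofReal_mul (by positivity), mul_div_assoc]
  rw [hfac]
  gcongr
  refine le_self_pow₀ h1 ?_
  exact Finset.card_ne_zero_of_mem (a := i) (by simpa using hi)

/-- A nonzero k has at least one nonzero coordinate, so r(Nk) ≥ N^α r(k), and α/λ > 1 turns this
into a gain of 1/N. It makes the frequencies divisible by N as harmless on average as the others. -/
theorem inv_korobovWeight_nsmul_rpow_le {d : ℕ} {α lam : ℝ} (hlam : 0 < lam) (h : lam < α)
    (γ : ℕ → ℝ≥0) {k : Fin d → ℤ} (hk : k ≠ 0) {N : ℕ} (hN : 0 < N) :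
    (korobovWeight α γ (fun j => (N : ℤ) * k j))⁻¹ ^ (1 / lam) ≤
      (N : ℝ≥0∞)⁻¹ * (korobovWeight α γ k)⁻¹ ^ (1 / lam) := by
  have hN1 : (1 : ℝ) ≤ N := by exact_mod_cast hN
  have hα : 0 ≤ α := (hlam.trans h).le
  have hNα : 0 < (N : ℝ) ^ α := by positivity
  have hle := korobovWeight_nsmul_ge hα γ hk hN
  calc (korobovWeight α γ (fun j => (N : ℤ) * k j))⁻¹ ^ (1 / lam)
      ≤ (ENNReal.ofReal ((N : ℝ) ^ α) * korobovWeight α γ k)⁻¹ ^ (1 / lam) := by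
        gcongr
    _ = (ENNReal.ofReal ((N : ℝ) ^ α))⁻¹ ^ (1 / lam) * (korobovWeight α γ k)⁻¹ ^ (1 / lam) := by
        rw [ENNReal.mul_inv (Or.inl (ENNReal.ofReal_pos.2 hNα).ne') (Or.inl ENNReal.ofReal_ne_top),
          ENNReal.mul_rpow_of_nonneg _ _ (by positivity)]
    _ ≤ _ := by
        gcongr
        rw [ENNReal.inv_rpow, ENNReal.ofReal_rpow_of_pos hNα, ENNReal.inv_le_inv,
          ← ENNReal.ofReal_natCast, ← Real.rpow_mul (by positivity)]
        refine ENNReal.ofReal_le_ofReal ?_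
        calc (N : ℝ) = (N : ℝ) ^ (1 : ℝ) := (Real.rpow_one _).symm
          _ ≤ _ := Real.rpow_le_rpow_of_exponent_le hN1 (by
            rw [mul_one_div]
            exact ((one_lt_div hlam).2 h).le)

open scoped Classical in
theorem tsum_dvd_inv_korobovWeight_rpow_le {d : ℕ} {α lam : ℝ} (hlam : 0 < lam) (h : lam < α)
    (γ : ℕ → ℝ≥0) {N : ℕ} (hN : 0 < N) :
    (∑' k : Fin d → ℤ, if k ≠ 0 ∧ ∀ j, (N : ℤ) ∣ k j then
        (korobovWeight α γ k)⁻¹ ^ (1 / lam) else 0) ≤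
      (N : ℝ≥0∞)⁻¹ * ENNReal.ofReal (∏ j : Fin d, zetaFactor α γ lam j) := by
  have hN0 : (N : ℤ) ≠ 0 := by exact_mod_cast hN.ne'
  have hinj : Function.Injective fun (k : Fin d → ℤ) (j : Fin d) => (N : ℤ) * k j :=
    fun a b hab => funext fun j => mul_left_cancel₀ hN0 (congrFun hab j)
  rw [← hinj.tsum_eq, ← tsum_inv_korobovWeight_rpow hlam h, ← ENNReal.tsum_mul_left]
  · refine ENNReal.tsum_le_tsum fun k => ?_
    split_ifs with hk
    · refine inv_korobovWeight_nsmul_rpow_le hlam h γ (fun h0 => hk.1 ?_) hN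
      subst h0
      funext j
      simp
    · exact zero_le
  · intro k hk
    have : k ≠ 0 ∧ ∀ j, (N : ℤ) ∣ k j := by
      by_contra h0
      simp [h0] at hk
    choose t ht using this.2
    exact ⟨t, funext fun j => (ht j).symm⟩

/-! ### Average of the worst-case error over generating vectors, and Markov's inequality -/

open scoped Classical in
theorem worstCaseError_rpow_le {d N : ℕ} {α lam : ℝ} (hlam : 1 / 2 ≤ lam) (h : lam < α)
    {γ : ℕ → ℝ≥0} (hγ : ∀ j, γ j ≤ 1) (hN : N.Prime) {z : Fin d → ℕ} (hz : z ∈ genVectors d N) :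
    worstCaseError α γ (qmcRule (latticePoints N z)) ^ (1 / lam) ≤
      ∑' k : Fin d → ℤ, if k ≠ 0 ∧ InDualLattice N z k then
        (korobovWeight α γ k)⁻¹ ^ (1 / lam) else 0 := by
  have hlam0 : 0 < lam := by linarith
  refine (ENNReal.rpow_le_rpow (worstCaseError_latticePoints_le (hlam0.trans h).le hγ hN hz)
    (by positivity : 0 ≤ 1 / lam)).trans ?_
  rw [← ENNReal.rpow_mul]
  -- This is where λ ≥ 1/2 enters: the power 1/(2λ) of a sum is at most the sum of the powers.
  have hp1 : 1 / 2 * (1 / lam) ≤ 1 := by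
    rw [div_mul_div_comm, div_le_one (by positivity)]
    linarith
  refine (ENNReal.rpow_tsum_le_tsum_rpow _ (by positivity) hp1).trans
    (ENNReal.tsum_le_tsum fun k => ?_)
  split_ifs
  · rw [← ENNReal.rpow_natCast, ← ENNReal.rpow_mul]
    refine le_of_eq ?_
    congr 1
    push_cast
    ring
  · rw [ENNReal.zero_rpow_of_pos (by positivity)]

open scoped Classical in
-- The factor 2 comes from 1/(N-1) ≤ 2/N; if N divides k, every z is dual to k.
theorem card_filter_inDualLattice_le {d N : ℕ} (hN : N.Prime) (k : Fin d → ℤ) :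
    (((genVectors d N).filter fun z => InDualLattice N z k).card : ℝ≥0∞) ≤
      (genVectors d N).card * (2 * (N : ℝ≥0∞)⁻¹ + if ∀ j, (N : ℤ) ∣ k j then 1 else 0) := by
  by_cases hk : ∀ j, (N : ℤ) ∣ k j
  · rw [if_pos hk]
    calc (((genVectors d N).filter fun z => InDualLattice N z k).card : ℝ≥0∞)
        ≤ (genVectors d N).card * 1 := by
          rw [mul_one]
          exact_mod_cast Finset.card_filter_le _ _
      _ ≤ _ := by gcongr; exact le_add_self
  · rw [if_neg hk, add_zero]
    push Not at hk
    obtain ⟨i, hi⟩ := hk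
    have h1 := card_filter_inDualLattice_mul_le hN hi
    have hN2 := hN.two_le
    have h2 : ((genVectors d N).filter fun z => InDualLattice N z k).card * N ≤
        (genVectors d N).card * 2 := by
      have : N ≤ 2 * (N - 1) := by omega
      nlinarith
    have hN0 : (N : ℝ≥0∞) ≠ 0 := by exact_mod_cast hN.ne_zero
    rw [← mul_assoc, ← div_eq_mul_inv,
      ENNReal.le_div_iff_mul_le (Or.inl hN0) (Or.inl (ENNReal.natCast_ne_top N))]
    exact_mod_cast h2

/-- Averaging bound for the power `1/lam` of the worst-case error. -/
theorem sum_worstCaseError_rpow_le {d N : ℕ} {α lam : ℝ} (hlam : 1 / 2 ≤ lam) (h : lam < α)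
    {γ : ℕ → ℝ≥0} (hγ : ∀ j, γ j ≤ 1) (hN : N.Prime) :
    ∑ z ∈ genVectors d N, worstCaseError α γ (qmcRule (latticePoints N z)) ^ (1 / lam) ≤
      (genVectors d N).card *
        (3 * (N : ℝ≥0∞)⁻¹ * ENNReal.ofReal (∏ j : Fin d, zetaFactor α γ lam j)) := by
  classical
  have hlam0 : 0 < lam := by linarith
  calc _ ≤ ∑ z ∈ genVectors d N, ∑' k : Fin d → ℤ, (if k ≠ 0 ∧ InDualLattice N z k then
        (korobovWeight α γ k)⁻¹ ^ (1 / lam) else 0) :=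
        Finset.sum_le_sum fun z hz => worstCaseError_rpow_le hlam h hγ hN hz
    _ = ∑' k : Fin d → ℤ, ∑ z ∈ genVectors d N, (if k ≠ 0 ∧ InDualLattice N z k then
        (korobovWeight α γ k)⁻¹ ^ (1 / lam) else 0) :=
        (Summable.tsum_finsetSum fun _ _ => ENNReal.summable).symm
    _ ≤ ∑' k : Fin d → ℤ, (genVectors d N).card * (2 * (N : ℝ≥0∞)⁻¹ *
          (korobovWeight α γ k)⁻¹ ^ (1 / lam) + if k ≠ 0 ∧ ∀ j, (N : ℤ) ∣ k j then
          (korobovWeight α γ k)⁻¹ ^ (1 / lam) else 0) := by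
        refine ENNReal.tsum_le_tsum fun k => ?_
        by_cases hk : k = 0
        · simp [hk]
        · simp only [ne_eq, hk, not_false_eq_true, true_and]
          rw [← Finset.sum_filter, Finset.sum_const, nsmul_eq_mul]
          calc _ ≤ _ := mul_le_mul_left (card_filter_inDualLattice_le hN k) _
            _ = _ := by
              rw [mul_assoc, add_mul]
              congr 2
              split_ifs <;> simp
    _ ≤ (genVectors d N).card * (2 * (N : ℝ≥0∞)⁻¹ *
          ENNReal.ofReal (∏ j : Fin d, zetaFactor α γ lam j) +
          (N : ℝ≥0∞)⁻¹ * ENNReal.ofReal (∏ j : Fin d, zetaFactor α γ lam j)) := by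
        rw [ENNReal.tsum_mul_left, ENNReal.tsum_add, ENNReal.tsum_mul_left,
          tsum_inv_korobovWeight_rpow hlam0 h]
        gcongr
        exact tsum_dvd_inv_korobovWeight_rpow_le hlam0 h γ hN.pos
    _ = _ := by ring

/-- The threshold for the worst-case error of a good generating vector. -/
noncomputable def errorThreshold (d : ℕ) (α : ℝ) (γ : ℕ → ℝ≥0) (η : ℝ) (M : ℕ) (lam : ℝ) : ℝ :=
  (6 * (∏ j : Fin d, zetaFactor α γ lam j) / ((1 - η) * M)) ^ lam

theorem prod_zetaFactor_pos {d : ℕ} {α lam : ℝ} (hlam : 0 < lam) (h : lam < α) (γ : ℕ → ℝ≥0) :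
    0 < ∏ j : Fin d, zetaFactor α γ lam j :=
  Finset.prod_pos fun j _ => zero_lt_one.trans_le (one_le_zetaFactor hlam h γ j)

/-- Markov's inequality for the power 1/λ of the worst-case error. The 6 in the threshold is the 3
of the averaging bound times the 2 from M ≤ 2N. -/
theorem card_filter_errorThreshold_lt_le {d N M : ℕ} {α lam η : ℝ} (hlam : 1 / 2 ≤ lam)
    (h : lam < α) {γ : ℕ → ℝ≥0} (hγ : ∀ j, γ j ≤ 1) (hη : η < 1) (hM : 2 ≤ M)
    (hN : N ∈ upperPrimes M) :
    (((genVectors d N).filter fun z => ENNReal.ofReal (errorThreshold d α γ η M lam) <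
      worstCaseError α γ (qmcRule (latticePoints N z))).card : ℝ≥0∞) ≤
      ENNReal.ofReal (1 - η) * (genVectors d N).card := by
  have hlam0 : 0 < lam := by linarith
  have hη' : 0 < 1 - η := by linarith
  have hMR : (0 : ℝ) < M := by exact_mod_cast (by omega : 0 < M)
  simp only [upperPrimes, Finset.mem_filter, Finset.mem_Ioc] at hN
  have hNp := hN.2
  have hNR : (0 : ℝ) < N := by exact_mod_cast hNp.pos
  have hMN : (M : ℝ) ≤ 2 * N := by exact_mod_cast (by omega : M ≤ 2 * N)
  have hP := prod_zetaFactor_pos (d := d) hlam0 h γ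
  set P := ∏ j : Fin d, zetaFactor α γ lam j with hPdef
  set t : ℝ := 6 * P / ((1 - η) * M) with ht
  have ht0 : 0 < t := by positivity
  have hTt : ENNReal.ofReal (errorThreshold d α γ η M lam) ^ (1 / lam) = ENNReal.ofReal t := by
    rw [errorThreshold, ← hPdef, ← ht, ENNReal.ofReal_rpow_of_pos (by positivity),
      ← Real.rpow_mul ht0.le, mul_one_div_cancel hlam0.ne', Real.rpow_one]
  have hsum := sum_worstCaseError_rpow_le (d := d) hlam h hγ hNp
  set B := (genVectors d N).filter fun z => ENNReal.ofReal (errorThreshold d α γ η M lam) <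
      worstCaseError α γ (qmcRule (latticePoints N z)) with hB
  have h1 : (B.card : ℝ≥0∞) * ENNReal.ofReal t ≤
      (genVectors d N).card * (3 * (N : ℝ≥0∞)⁻¹ * ENNReal.ofReal P) := by
    refine le_trans ?_ hsum
    rw [← nsmul_eq_mul]
    refine (Finset.card_nsmul_le_sum B _ _ fun z hz => ?_).trans
      (Finset.sum_le_sum_of_subset (Finset.filter_subset _ _))
    rw [← hTt]
    exact ENNReal.rpow_le_rpow (Finset.mem_filter.1 hz).2.le (by positivity)
  have h2 : 3 * (N : ℝ≥0∞)⁻¹ * ENNReal.ofReal P ≤ ENNReal.ofReal (1 - η) * ENNReal.ofReal t := by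
    rw [← ENNReal.ofReal_natCast, ← ENNReal.ofReal_inv_of_pos hNR,
      ← ENNReal.ofReal_ofNat, ← ENNReal.ofReal_mul (by positivity),
      ← ENNReal.ofReal_mul (by positivity), ← ENNReal.ofReal_mul (by positivity)]
    refine ENNReal.ofReal_le_ofReal ?_
    rw [ht]
    have : (1 - η) * (6 * P / ((1 - η) * M)) = 6 * P / M := by field_simp
    rw [this, ← div_eq_mul_inv, div_mul_eq_mul_div, div_le_div_iff₀ hNR hMR]
    nlinarith
  have h3 := h1.trans (mul_le_mul_right h2 _)
  rw [← mul_assoc] at h3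
  have h4 := (ENNReal.mul_le_mul_iff_left (ENNReal.ofReal_pos.2 ht0).ne'
    ENNReal.ofReal_ne_top).1 h3
  rwa [mul_comm] at h4

/-! ### Admissible primes dividing a fixed integer -/

/-- The product of the primes in question divides m, and each satisfies p² ≥ 2p ≥ M. Hence M to the
power of their number is at most m². -/
theorem card_filter_dvd_upperPrimes_mul_log_le {M : ℕ} (hM : 2 ≤ M) {m : ℤ} (hm : m ≠ 0) :
    (((upperPrimes M).filter fun N : ℕ => (N : ℤ) ∣ m).card : ℝ) * Real.log M ≤
      2 * Real.log |(m : ℝ)| := by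
  set S := (upperPrimes M).filter fun N : ℕ => (N : ℤ) ∣ m with hS
  have hmem : ∀ p ∈ S, p.Prime ∧ M ≤ p ^ 2 ∧ p ∣ m.natAbs := fun p hp => by
    simp only [hS, upperPrimes, Finset.mem_filter, Finset.mem_Ioc] at hp
    have h2 := hp.1.2.two_le
    refine ⟨hp.1.2, ?_, Int.natCast_dvd.1 hp.2⟩
    have : M ≤ 2 * p := by omega
    nlinarith
  have hdvd : ∏ p ∈ S, p ∣ m.natAbs :=
    Finset.prod_primes_dvd _ (fun p hp => (hmem p hp).1.prime) fun p hp => (hmem p hp).2.2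
  have hle : ∏ p ∈ S, p ≤ m.natAbs := Nat.le_of_dvd (Int.natAbs_pos.2 hm) hdvd
  have h1 : M ^ S.card ≤ m.natAbs ^ 2 := by
    calc M ^ S.card ≤ ∏ p ∈ S, p ^ 2 := Finset.pow_card_le_prod _ _ _ fun p hp => (hmem p hp).2.1
      _ = (∏ p ∈ S, p) ^ 2 := Finset.prod_pow _ _ _
      _ ≤ _ := Nat.pow_le_pow_left hle 2
  have h2 : ((M : ℝ)) ^ S.card ≤ |(m : ℝ)| ^ 2 := by
    have h3 : ((m.natAbs : ℕ) : ℝ) = |(m : ℝ)| := by rw [Nat.cast_natAbs, Int.cast_abs]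
    rw [← h3]
    exact_mod_cast h1
  have hM0 : (0 : ℝ) < M := by exact_mod_cast (by omega : 0 < M)
  have h3 := Real.log_le_log (by positivity) h2
  rwa [Real.log_pow, Real.log_pow, Nat.cast_ofNat] at h3

/-! ### Expectations under the random draws -/

theorem tsum_drawLaw_mul (d r M : ℕ) (hM : 2 ≤ M) (G : ℕ × (Fin r → Fin d → ℕ) → ℝ≥0∞) :
    ∑' p, G p * drawLaw d r M hM p =
      ((upperPrimes M).card : ℝ≥0∞)⁻¹ * ∑ N ∈ upperPrimes M,
        ((genTuples d r N).card : ℝ≥0∞)⁻¹ * ∑ z ∈ genTuples d r N, G (N, z) := by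
  classical
  have happly : ∀ N z, drawLaw d r M hM (N, z) =
      if N ∈ upperPrimes M ∧ z ∈ genTuples d r N then
        ((upperPrimes M).card : ℝ≥0∞)⁻¹ * ((genTuples d r N).card : ℝ≥0∞)⁻¹ else 0 := fun N z => by
    rw [drawLaw, PMF.bindOnSupport_apply, tsum_eq_single N]
    · by_cases hN : N ∈ upperPrimes M
      · have h0 : PMF.uniformOfFinset (upperPrimes M) (upperPrimes_nonempty hM) N ≠ 0 :=
          (PMF.mem_support_iff _ _).1 ((PMF.mem_support_uniformOfFinset_iff _ _).2 hN)
        rw [dif_neg h0, PMF.uniformOfFinset_apply_of_mem _ hN, PMF.map_apply, tsum_eq_single z]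
        · rw [if_pos rfl, PMF.uniformOfFinset_apply]
          simp [hN]
        · intro z' hz'
          rw [if_neg fun h => hz' (Prod.ext_iff.1 h).2.symm]
      · rw [dif_pos (PMF.uniformOfFinset_apply_of_notMem _ hN), mul_zero, if_neg fun h => hN h.1]
    · intro N' hN'
      split_ifs with h0
      · simp
      · rw [PMF.map_apply, ENNReal.tsum_eq_zero.2, mul_zero]
        intro z'
        rw [if_neg fun h => hN' (Prod.ext_iff.1 h).1.symm]
  rw [ENNReal.tsum_prod', tsum_eq_sum (s := upperPrimes M), Finset.mul_sum]
  · refine Finset.sum_congr rfl fun N hN => ?_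
    rw [tsum_eq_sum (s := genTuples d r N), Finset.mul_sum, Finset.mul_sum]
    · refine Finset.sum_congr rfl fun z hz => ?_
      rw [happly, if_pos ⟨hN, hz⟩]
      ring
    · intro z hz
      rw [happly, if_neg fun h => hz h.2, mul_zero]
  · intro N hN
    refine ENNReal.tsum_eq_zero.2 fun z => ?_
    rw [happly, if_neg fun h => hN h.1, mul_zero]

/-- Only this half of Tonelli's theorem is needed, and it requires no measurability of F. -/
theorem lintegral_shiftedLaw_le (d r M : ℕ) (hM : 2 ≤ M)
    (F : (ℕ × (Fin r → Fin d → ℕ)) × (Fin d → ℝ) → ℝ≥0∞) :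
    ∫⁻ ω, F ω ∂shiftedLaw d r M hM ≤
      ((upperPrimes M).card : ℝ≥0∞)⁻¹ * ∑ N ∈ upperPrimes M,
        ((genTuples d r N).card : ℝ≥0∞)⁻¹ * ∑ z ∈ genTuples d r N,
          ∫⁻ Δ in unitCube d, F ((N, z), Δ) := by
  rw [← tsum_drawLaw_mul d r M hM fun p => ∫⁻ Δ in unitCube d, F (p, Δ), shiftedLaw]
  refine (lintegral_prod_le _).trans_eq ?_
  rw [lintegral_countable']
  refine tsum_congr fun p => ?_
  rw [PMF.toMeasure_apply_singleton _ _ (measurableSet_singleton p)]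

theorem card_genTuples (d r N : ℕ) : (genTuples d r N).card = (genVectors d N).card ^ r := by
  simp [genTuples]

theorem card_filter_genTuples_forall {d r N : ℕ} (p : (Fin d → ℕ) → Prop) [DecidablePred p]
    [DecidablePred fun z : Fin r → Fin d → ℕ => ∀ j, p (z j)] :
    ((genTuples d r N).filter fun z => ∀ j, p (z j)).card =
      ((genVectors d N).filter p).card ^ r := by
  have : ((genTuples d r N).filter fun z => ∀ j, p (z j)) =
      Fintype.piFinset fun _ : Fin r => (genVectors d N).filter p := by
    ext z
    simp [genTuples, Fintype.mem_piFinset, forall_and]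
  rw [this]
  simp

/-- Counting form of the fact that each entry of a uniform tuple is itself uniform. -/
theorem card_filter_genTuples_apply_mul {d r N : ℕ} (p : (Fin d → ℕ) → Prop) [DecidablePred p]
    (i : Fin r) :
    ((genTuples d r N).filter fun z => p (z i)).card * (genVectors d N).card =
      ((genVectors d N).filter p).card * (genTuples d r N).card := by
  classical
  have : ((genTuples d r N).filter fun z => p (z i)) =
      Fintype.piFinset (Function.update (fun _ : Fin r => genVectors d N) i
        ((genVectors d N).filter p)) := by
    ext z
    simp only [genTuples, Finset.mem_filter, Fintype.mem_piFinset]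
    constructor
    · intro h j
      by_cases hj : j = i
      · subst hj
        simpa using ⟨h.1 j, h.2⟩
      · simpa [Function.update_of_ne hj] using h.1 j
    · intro h
      have hi := h i
      rw [Function.update_self, Finset.mem_filter] at hi
      refine ⟨fun j => ?_, hi.2⟩
      by_cases hj : j = i
      · subst hj
        exact hi.1
      · simpa [Function.update_of_ne hj] using h j
  rw [this, genTuples, Fintype.card_piFinset, Fintype.card_piFinset,
    ← Finset.mul_prod_erase Finset.univ _ (Finset.mem_univ i),
    ← Finset.mul_prod_erase Finset.univ (fun _ => (genVectors d N).card) (Finset.mem_univ i),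
    Function.update_self]
  rw [Finset.prod_congr rfl fun j hj => by
    rw [Function.update_of_ne (Finset.ne_of_mem_erase hj)]]
  ring

open scoped Classical in
theorem inv_card_mul_card_filter_genTuples_le {d r M N : ℕ} (hN : N ∈ upperPrimes M)
    (k : Fin d → ℤ) (i : Fin r) :
    ((genTuples d r N).card : ℝ≥0∞)⁻¹ *
        ((genTuples d r N).filter fun z => InDualLattice N (z i) k).card ≤
      2 * (N : ℝ≥0∞)⁻¹ + if ∀ j, (N : ℤ) ∣ k j then 1 else 0 := by
  have hNp := (Finset.mem_filter.1 hN).2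
  have hT0 : ((genTuples d r N).card : ℝ≥0∞) ≠ 0 := by
    exact_mod_cast (Finset.card_pos.2 (genTuples_nonempty d r hN)).ne'
  have hG0 : ((genVectors d N).card : ℝ≥0∞) ≠ 0 := by
    have : 0 < (genVectors d N).card := by
      rw [card_genVectors]
      have := hNp.two_le
      exact Nat.pow_pos (by omega)
    exact_mod_cast this.ne'
  have h1 := card_filter_inDualLattice_le hNp k
  have h2 : (((genTuples d r N).filter fun z => InDualLattice N (z i) k).card : ℝ≥0∞) *
      (genVectors d N).card = ((genVectors d N).filter fun z => InDualLattice N z k).card *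
        (genTuples d r N).card := by
    exact_mod_cast card_filter_genTuples_apply_mul (fun z => InDualLattice N z k) i
  rw [mul_comm, ← div_eq_mul_inv]
  refine ENNReal.div_le_of_le_mul ?_
  refine (ENNReal.mul_le_mul_iff_left hG0 (ENNReal.natCast_ne_top _)).1 ?_
  rw [h2]
  calc _ ≤ _ := mul_le_mul_left h1 _
    _ = _ := by ring

/-! ### Probability over N that a fixed frequency is dual -/

theorem ofReal_abs_rpow_le_korobovWeight {d : ℕ} {α : ℝ} (hα : 0 ≤ α) {γ : ℕ → ℝ≥0}
    (hγ : ∀ j, γ j ≤ 1) {k : Fin d → ℤ} {i : Fin d} (hi : k i ≠ 0) :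
    ENNReal.ofReal (|(k i : ℝ)| ^ α) ≤ korobovWeight α γ k := by
  have hle : ∀ j, ENNReal.ofReal (|(k j : ℝ)| ^ α) ≤
      ENNReal.ofReal (|(k j : ℝ)| ^ α) / (γ j : ℝ≥0∞) := fun j =>
    calc ENNReal.ofReal (|(k j : ℝ)| ^ α) = ENNReal.ofReal (|(k j : ℝ)| ^ α) / 1 := by simp
      _ ≤ _ := ENNReal.div_le_div_left (by exact_mod_cast hγ j) _
  refine (hle i).trans ?_
  refine Finset.single_le_prod'
    (f := fun j : Fin d => ENNReal.ofReal (|(k j : ℝ)| ^ α) / (γ j : ℝ≥0∞))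
    (fun j hj => (ENNReal.one_le_ofReal.2 ?_).trans (hle j)) (by simpa using hi)
  have hk : k j ≠ 0 := (Finset.mem_filter.1 hj).2
  exact Real.one_le_rpow (by exact_mod_cast Int.one_le_abs hk) hα

open scoped Classical in
-- The part 2/N contributes at most 4/M. For the divisibility part, the factor log M in the prime
-- divisor count cancels against the one in Chebyshev's bound; R plays the role of r(k).
theorem average_dual_probability_le {c : ℝ} (hc : 0 < c)
    (hcheb : ∀ M : ℕ, 2 ≤ M → c * M ≤ ((upperPrimes M).card : ℝ) * Real.log M)
    {d M : ℕ} {α δ R : ℝ} (hα : 0 < α) (hδ : 0 < δ) (hδα : δ ≤ 1 / α) (hM : 2 ≤ M)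
    {k : Fin d → ℤ} {i : Fin d} (hi : k i ≠ 0) (hR : 1 ≤ R) (hkR : |(k i : ℝ)| ^ α ≤ R) :
    ((upperPrimes M).card : ℝ)⁻¹ * ∑ N ∈ upperPrimes M,
        (2 * (N : ℝ)⁻¹ + if ∀ j, (N : ℤ) ∣ k j then 1 else 0) ≤
      (4 + 2 / c) / (δ * α * M) * R ^ δ := by
  have hM0 : (0 : ℝ) < M := by exact_mod_cast (by omega : 0 < M)
  have hU : (0 : ℝ) < (upperPrimes M).card := by
    exact_mod_cast Finset.card_pos.2 (upperPrimes_nonempty hM)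
  set U : ℝ := ((upperPrimes M).card : ℝ) with hUdef
  set m : ℝ := (((upperPrimes M).filter fun N : ℕ => (N : ℤ) ∣ k i).card : ℝ) with hm
  have hk0 : 0 < |(k i : ℝ)| := by positivity
  have hlogM : 0 < Real.log M := Real.log_pos (by exact_mod_cast (by omega : 1 < M))
  have h1 : m * Real.log M ≤ 2 * Real.log |(k i : ℝ)| :=
    card_filter_dvd_upperPrimes_mul_log_le hM hi
  have h2 : α * Real.log |(k i : ℝ)| ≤ Real.log R := by
    rw [← Real.log_rpow hk0]
    exact Real.log_le_log (by positivity) hkR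
  -- The remaining logarithm of the frequency is traded for a small power of r(k), at the cost of
  -- 1/δ.
  have h3 : Real.log R ≤ R ^ δ / δ := Real.log_le_rpow_div (by linarith) hδ
  have hRδ : 1 ≤ R ^ δ := Real.one_le_rpow hR hδ.le
  have hδα' : δ * α ≤ 1 := by rwa [le_div_iff₀ hα] at hδα
  have h4 : m ≤ U * (2 / c / (δ * α * M) * R ^ δ) := by
    have h5 : α * (m * Real.log M) ≤ 2 * (R ^ δ / δ) := by nlinarith
    have h6 := hcheb M hM
    have h7 : (c * M) * (α * (m * Real.log M)) ≤ (U * Real.log M) * (2 * (R ^ δ / δ)) :=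
      mul_le_mul h6 h5 (by positivity) (by positivity)
    have h8 : (c * M * α * m) * Real.log M ≤ (U * (2 * (R ^ δ / δ))) * Real.log M := by
      calc _ = (c * M) * (α * (m * Real.log M)) := by ring
        _ ≤ _ := h7
        _ = _ := by ring
    have h9 := le_of_mul_le_mul_right h8 hlogM
    have h10 : m ≤ U * (2 * (R ^ δ / δ)) / (c * M * α) := by
      rw [le_div_iff₀ (by positivity)]
      linarith
    refine h10.trans_eq ?_
    field_simp
  have hsum : ∑ N ∈ upperPrimes M, (2 * (N : ℝ)⁻¹ + if ∀ j, (N : ℤ) ∣ k j then (1 : ℝ) else 0) ≤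
      U * (4 / M) + m := by
    rw [Finset.sum_add_distrib]
    refine add_le_add ?_ ?_
    · rw [hUdef, ← nsmul_eq_mul]
      refine Finset.sum_le_card_nsmul _ _ _ fun N hN => ?_
      simp only [upperPrimes, Finset.mem_filter, Finset.mem_Ioc] at hN
      have hNR : (0 : ℝ) < N := by exact_mod_cast hN.2.pos
      have hMN : (M : ℝ) ≤ 2 * N := by exact_mod_cast (by omega : M ≤ 2 * N)
      rw [← div_eq_mul_inv, div_le_div_iff₀ hNR hM0]
      linarith
    · rw [← Finset.sum_filter, Finset.sum_const, nsmul_eq_mul, mul_one, hm]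
      refine Nat.cast_le.2 (Finset.card_le_card fun N hN => ?_)
      rw [Finset.mem_filter] at hN ⊢
      exact ⟨hN.1, hN.2 i⟩
  -- The condition δα ≤ 1 lets the 4/M term share the form of the divisibility term.
  have h11 : 4 / (M : ℝ) ≤ 4 / (δ * α * M) * R ^ δ := by
    have : 4 / (M : ℝ) ≤ 4 / (δ * α * M) := by
      apply div_le_div_of_nonneg_left (by norm_num) (by positivity)
      nlinarith
    refine this.trans ?_
    exact le_mul_of_one_le_right (by positivity) hRδ
  rw [inv_mul_le_iff₀ hU]
  calc _ ≤ _ := hsum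
    _ ≤ U * (4 / (δ * α * M) * R ^ δ) + U * (2 / c / (δ * α * M) * R ^ δ) := by gcongr
    _ = _ := by ring

/-! ### Good and bad draws, and the final estimate -/

open scoped Classical in
/-- The squared Fourier coefficient `|f̂(k)|²` if `k ≠ 0` and `r(k)⁻¹ ≤ T`, and `0` otherwise. -/
noncomputable def goodCoeff {d : ℕ} (α : ℝ) (γ : ℕ → ℝ≥0) (T : ℝ≥0∞) (f : (Fin d → ℝ) → ℝ)
    (k : Fin d → ℤ) : ℝ≥0∞ :=
  if k ≠ 0 ∧ (korobovWeight α γ k)⁻¹ ≤ T then ‖cubeFourierCoeff f k‖ₑ ^ 2 else 0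

open scoped Classical in
-- If every draw exceeds T, the whole sum is at most 1. Otherwise minimality puts z* below T, so its
-- dual vectors satisfy 1/r(k) ≤ T. The sum over j then removes the dependence on the selection by a
-- union bound.
theorem tsum_errorCoeff_sq_le {d r M N : ℕ} {α : ℝ} (hα : 0 ≤ α) {γ : ℕ → ℝ≥0}
    (hγ : ∀ j, γ j ≤ 1) {sel : ℕ → (Fin r → Fin d → ℕ) → Fin r} (hsel : IsArgminRule α γ M sel)
    (hN : N ∈ upperPrimes M) {z : Fin r → Fin d → ℕ} (hz : z ∈ genTuples d r N)
    {f : (Fin d → ℝ) → ℝ} (hf : f ∈ korobovUnitBall d α γ) (T : ℝ≥0∞) :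
    ∑' k, ‖errorCoeff N (z (sel N z)) f k‖ₑ ^ 2 ≤
      (if ∀ j, T < worstCaseError α γ (qmcRule (latticePoints N (z j))) then 1 else 0) +
        ∑' k, goodCoeff α γ T f k * ∑ j, if InDualLattice N (z j) k then 1 else 0 := by
  have hNp := (Finset.mem_filter.1 hN).2
  split_ifs with hbad
  · refine le_trans ?_ le_self_add
    refine le_trans (ENNReal.tsum_le_tsum fun k => ?_)
      (tsum_enorm_sq_mul_korobovWeight_sq_le_one hf)
    rw [errorCoeff]
    split_ifs
    · exact le_mul_of_one_le_right' (one_le_pow₀ (one_le_korobovWeight hα hγ k))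
    · simp
  · rw [zero_add]
    push Not at hbad
    obtain ⟨j, hj⟩ := hbad
    have hstar := (hsel N hN z hz j).trans hj
    refine ENNReal.tsum_le_tsum fun k => ?_
    rw [errorCoeff]
    split_ifs with h
    · have hw := (inv_korobovWeight_le_worstCaseError hα hγ hNp
        (Fintype.mem_piFinset.1 hz (sel N z)) h.1 h.2).trans hstar
      rw [goodCoeff, if_pos ⟨h.1, hw⟩]
      refine le_mul_of_one_le_right' ?_
      calc (1 : ℝ≥0∞) = if InDualLattice N (z (sel N z)) k then 1 else 0 := by rw [if_pos h.2]
        _ ≤ _ := Finset.single_le_sum (f := fun j => if InDualLattice N (z j) k then (1 : ℝ≥0∞) else 0)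
          (fun _ _ => zero_le) (Finset.mem_univ _)
    · simp

open scoped Classical in
theorem average_tsum_errorCoeff_sq_le {d r M N : ℕ} {α lam η : ℝ} (hlam : 1 / 2 ≤ lam)
    (h : lam < α) {γ : ℕ → ℝ≥0} (hγ : ∀ j, γ j ≤ 1) (hη : η < 1) (hM : 2 ≤ M)
    {sel : ℕ → (Fin r → Fin d → ℕ) → Fin r} (hsel : IsArgminRule α γ M sel)
    (hN : N ∈ upperPrimes M) {f : (Fin d → ℝ) → ℝ} (hf : f ∈ korobovUnitBall d α γ) :
    ((genTuples d r N).card : ℝ≥0∞)⁻¹ * ∑ z ∈ genTuples d r N,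
        ∑' k, ‖errorCoeff N (z (sel N z)) f k‖ₑ ^ 2 ≤
      ENNReal.ofReal (1 - η) ^ r + r * ∑' k,
        goodCoeff α γ (ENNReal.ofReal (errorThreshold d α γ η M lam)) f k *
          (2 * (N : ℝ≥0∞)⁻¹ + if ∀ j, (N : ℤ) ∣ k j then 1 else 0) := by
  have hα : 0 ≤ α := by linarith
  set T := ENNReal.ofReal (errorThreshold d α γ η M lam) with hT
  have hC0 : ((genTuples d r N).card : ℝ≥0∞) ≠ 0 := by
    exact_mod_cast (Finset.card_pos.2 (genTuples_nonempty d r hN)).ne'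
  have hCt : ((genTuples d r N).card : ℝ≥0∞) ≠ ∞ := ENNReal.natCast_ne_top _
  set W := ((genTuples d r N).card : ℝ≥0∞)⁻¹ with hW
  refine (mul_le_mul_right (Finset.sum_le_sum fun z hz =>
    tsum_errorCoeff_sq_le hα hγ hsel hN hz hf T) _).trans ?_
  rw [Finset.sum_add_distrib, mul_add]
  refine add_le_add ?_ ?_
  · rw [← Finset.sum_filter, Finset.sum_const, nsmul_eq_mul, mul_one,
      card_filter_genTuples_forall fun z =>
        T < worstCaseError α γ (qmcRule (latticePoints N z))]
    have hb := card_filter_errorThreshold_lt_le (d := d) hlam h hγ hη hM hN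
    rw [← hT] at hb
    rw [hW, mul_comm, ← div_eq_mul_inv]
    refine ENNReal.div_le_of_le_mul ?_
    rw [card_genTuples]
    push_cast
    rw [← mul_pow]
    gcongr
  · rw [← Summable.tsum_finsetSum fun _ _ => ENNReal.summable, ← ENNReal.tsum_mul_left,
      ← ENNReal.tsum_mul_left]
    refine ENNReal.tsum_le_tsum fun k => ?_
    rw [← Finset.mul_sum, Finset.sum_comm]
    calc _ = goodCoeff α γ T f k * ∑ j : Fin r, W *
          ((genTuples d r N).filter fun z => InDualLattice N (z j) k).card := by
          rw [← Finset.mul_sum, mul_left_comm]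
          congr 2
          refine Finset.sum_congr rfl fun j _ => ?_
          rw [← Finset.sum_filter, Finset.sum_const, nsmul_eq_mul, mul_one]
      _ ≤ goodCoeff α γ T f k * ∑ j : Fin r,
          (2 * (N : ℝ≥0∞)⁻¹ + if ∀ j, (N : ℤ) ∣ k j then 1 else 0) := by
          gcongr with j _
          exact inv_card_mul_card_filter_genTuples_le hN k j
      _ = _ := by
          rw [Finset.sum_const, Finset.card_univ, Fintype.card_fin, nsmul_eq_mul]
          ring

open scoped Classical in
-- With R = r(k) and RT ≥ 1, the identity R² T^(2-δ) = R^δ (RT)^(2-δ) gives R^δ ≤ R² T^(2-δ), which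
-- uses δ ≤ 1/α < 2. The factor R² is what the norm of f controls.
theorem goodCoeff_mul_average_le {c : ℝ} (hc : 0 < c)
    (hcheb : ∀ M : ℕ, 2 ≤ M → c * M ≤ ((upperPrimes M).card : ℝ) * Real.log M)
    {d M : ℕ} {α δ T : ℝ} (hα : 1 / 2 < α) (hδ : 0 < δ) (hδα : δ ≤ 1 / α) (hM : 2 ≤ M)
    {γ : ℕ → ℝ≥0} (hγ : ∀ j, γ j ≤ 1) (hT : 0 < T) (f : (Fin d → ℝ) → ℝ) (k : Fin d → ℤ) :
    goodCoeff α γ (ENNReal.ofReal T) f k * (((upperPrimes M).card : ℝ≥0∞)⁻¹ *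
        ∑ N ∈ upperPrimes M, (2 * (N : ℝ≥0∞)⁻¹ + if ∀ j, (N : ℤ) ∣ k j then 1 else 0)) ≤
      ‖cubeFourierCoeff f k‖ₑ ^ 2 * korobovWeight α γ k ^ 2 *
        ENNReal.ofReal ((4 + 2 / c) / (δ * α * M) * T ^ (2 - δ)) := by
  have hα0 : 0 < α := by linarith
  have hM0 : (0 : ℝ) < M := by exact_mod_cast (by omega : 0 < M)
  have hK : 0 < (4 + 2 / c) / (δ * α * M) * T ^ (2 - δ) := by positivity
  have hδ2 : 0 ≤ 2 - δ := by
    have : 1 / α ≤ 2 := by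
      rw [div_le_iff₀ hα0]
      linarith
    linarith
  by_cases hk : k ≠ 0 ∧ (korobovWeight α γ k)⁻¹ ≤ ENNReal.ofReal T
  swap
  · rw [goodCoeff, if_neg hk, zero_mul]
    exact zero_le
  rw [goodCoeff, if_pos hk]
  by_cases hw : korobovWeight α γ k = ∞
  · by_cases ha : ‖cubeFourierCoeff f k‖ₑ = 0
    · simp [ha]
    · rw [hw, ENNReal.top_pow two_ne_zero, ENNReal.mul_top (pow_ne_zero 2 ha),
        ENNReal.top_mul (ENNReal.ofReal_pos.2 hK).ne']
      exact le_top
  obtain ⟨i, hi⟩ := Function.ne_iff.1 hk.1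
  have hw1 := one_le_korobovWeight hα0.le hγ k
  set R := (korobovWeight α γ k).toReal with hRdef
  have hRw : korobovWeight α γ k = ENNReal.ofReal R := (ENNReal.ofReal_toReal hw).symm
  have hR : 1 ≤ R := by
    rw [hRw] at hw1
    exact ENNReal.one_le_ofReal.1 hw1
  have hR0 : 0 < R := by linarith
  have hkR : |(k i : ℝ)| ^ α ≤ R := by
    have := ofReal_abs_rpow_le_korobovWeight hα0.le hγ (k := k) hi
    rw [hRw] at this
    exact (ENNReal.ofReal_le_ofReal_iff hR0.le).1 this
  have hRT : 1 ≤ R * T := by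
    have := hk.2
    rw [hRw, ← ENNReal.ofReal_inv_of_pos hR0, ENNReal.ofReal_le_ofReal_iff hT.le,
      inv_le_iff_one_le_mul₀' hR0] at this
    exact this
  have hRδ : R ^ δ ≤ R ^ 2 * T ^ (2 - δ) := by
    have h1 : R ^ 2 * T ^ (2 - δ) = R ^ δ * (R * T) ^ (2 - δ) := by
      rw [Real.mul_rpow hR0.le hT.le, ← mul_assoc, ← Real.rpow_add hR0]
      norm_num
    rw [h1]
    exact le_mul_of_one_le_right (by positivity) (Real.one_le_rpow hRT hδ2)
  have hU : (0 : ℝ) < (upperPrimes M).card := by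
    exact_mod_cast Finset.card_pos.2 (upperPrimes_nonempty hM)
  have hcast : ((upperPrimes M).card : ℝ≥0∞)⁻¹ *
        ∑ N ∈ upperPrimes M, (2 * (N : ℝ≥0∞)⁻¹ + if ∀ j, (N : ℤ) ∣ k j then 1 else 0) =
      ENNReal.ofReal (((upperPrimes M).card : ℝ)⁻¹ * ∑ N ∈ upperPrimes M,
        (2 * (N : ℝ)⁻¹ + if ∀ j, (N : ℤ) ∣ k j then 1 else 0)) := by
    have hnn : ∀ N : ℕ, (0 : ℝ) ≤ if ∀ j, (N : ℤ) ∣ k j then 1 else 0 := fun N => by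
      split_ifs
      · exact zero_le_one
      · exact le_rfl
    rw [ENNReal.ofReal_mul (inv_nonneg.2 hU.le), ENNReal.ofReal_inv_of_pos hU, ENNReal.ofReal_natCast,
      ENNReal.ofReal_sum_of_nonneg fun N _ => add_nonneg (by positivity) (hnn N)]
    congr 1
    refine Finset.sum_congr rfl fun N hN => ?_
    have hNR : (0 : ℝ) < N := by exact_mod_cast (Finset.mem_filter.1 hN).2.pos
    rw [ENNReal.ofReal_add (by positivity) (hnn N), ENNReal.ofReal_mul zero_le_two,
      ENNReal.ofReal_inv_of_pos hNR, ENNReal.ofReal_natCast, ENNReal.ofReal_ofNat]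
    congr 1
    split_ifs
    · exact ENNReal.ofReal_one.symm
    · exact ENNReal.ofReal_zero.symm
  rw [hcast, mul_assoc]
  refine mul_le_mul_right ?_ _
  rw [hRw, ← ENNReal.ofReal_pow hR0.le, ← ENNReal.ofReal_mul (by positivity)]
  refine ENNReal.ofReal_le_ofReal ?_
  refine (average_dual_probability_le hc hcheb hα0 hδ hδα hM hi hR hkR).trans ?_
  calc _ ≤ (4 + 2 / c) / (δ * α * M) * (R ^ 2 * T ^ (2 - δ)) := by gcongr
    _ = _ := by ring

theorem lintegral_shiftedLatticeRule_le {c : ℝ} (hc : 0 < c)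
    (hcheb : ∀ M : ℕ, 2 ≤ M → c * M ≤ ((upperPrimes M).card : ℝ) * Real.log M)
    {d r M : ℕ} {α lam δ η : ℝ} (hlam : 1 / 2 ≤ lam) (h : lam < α) (hδ : 0 < δ) (hδα : δ ≤ 1 / α)
    {γ : ℕ → ℝ≥0} (hγ : ∀ j, γ j ≤ 1) (hη : η < 1) (hM : 2 ≤ M)
    {sel : ℕ → (Fin r → Fin d → ℕ) → Fin r} (hsel : IsArgminRule α γ M sel)
    {f : (Fin d → ℝ) → ℝ} (hf : f ∈ korobovUnitBall d α γ) :
    ∫⁻ ω, ENNReal.ofReal (|cubeIntegral f - shiftedLatticeRule sel ω f| ^ 2)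
        ∂shiftedLaw d r M hM ≤
      ENNReal.ofReal (r * ((4 + 2 / c) / (δ * α * M) *
        errorThreshold d α γ η M lam ^ (2 - δ)) + (1 - η) ^ r) := by
  classical
  have hlam0 : 0 < lam := by linarith
  have hα : 0 < α := by linarith
  have hM0 : (0 : ℝ) < M := by exact_mod_cast (by omega : 0 < M)
  have hη' : 0 < 1 - η := by linarith
  have hT : 0 < errorThreshold d α γ η M lam := by
    have := prod_zetaFactor_pos (d := d) hlam0 h γ
    rw [errorThreshold]
    positivity
  have hU0 : ((upperPrimes M).card : ℝ≥0∞) ≠ 0 := by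
    exact_mod_cast (Finset.card_pos.2 (upperPrimes_nonempty hM)).ne'
  set K := (4 + 2 / c) / (δ * α * M) * errorThreshold d α γ η M lam ^ (2 - δ) with hK
  have hK0 : 0 < K := by positivity
  -- The average over N is moved inside the sum over k before estimating: for a single N dividing k,
  -- the dual probability bound is not small.
  refine (lintegral_shiftedLaw_le d r M hM _).trans ?_
  calc _ ≤ ((upperPrimes M).card : ℝ≥0∞)⁻¹ * ∑ N ∈ upperPrimes M,
        (ENNReal.ofReal (1 - η) ^ r + r * ∑' k,
        goodCoeff α γ (ENNReal.ofReal (errorThreshold d α γ η M lam)) f k *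
          (2 * (N : ℝ≥0∞)⁻¹ + if ∀ j, (N : ℤ) ∣ k j then 1 else 0)) := by
        gcongr with N hN
        refine le_trans (le_of_eq ?_)
          (average_tsum_errorCoeff_sq_le hlam h hγ hη hM hsel hN hf)
        congr 1
        refine Finset.sum_congr rfl fun z hz => ?_
        simp only [shiftedLatticeRule]
        exact lintegral_shiftPoints_eq hf.1 (Finset.mem_filter.1 hN).2
          (Fintype.mem_piFinset.1 hz (sel N z))
    _ = ENNReal.ofReal (1 - η) ^ r + r * ∑' k,
        goodCoeff α γ (ENNReal.ofReal (errorThreshold d α γ η M lam)) f k *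
          (((upperPrimes M).card : ℝ≥0∞)⁻¹ * ∑ N ∈ upperPrimes M,
            (2 * (N : ℝ≥0∞)⁻¹ + if ∀ j, (N : ℤ) ∣ k j then 1 else 0)) := by
        rw [Finset.sum_add_distrib, Finset.sum_const, nsmul_eq_mul, mul_add, ← mul_assoc,
          ENNReal.inv_mul_cancel hU0 (ENNReal.natCast_ne_top _), one_mul, ← Finset.mul_sum,
          ← Summable.tsum_finsetSum fun _ _ => ENNReal.summable, mul_left_comm,
          ← ENNReal.tsum_mul_left]
        congr 2
        refine tsum_congr fun k => ?_
        rw [← Finset.mul_sum, mul_left_comm]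
    _ ≤ ENNReal.ofReal (1 - η) ^ r + r * ∑' k, ‖cubeFourierCoeff f k‖ₑ ^ 2 *
          korobovWeight α γ k ^ 2 * ENNReal.ofReal K := by
        refine add_le_add le_rfl (mul_le_mul' le_rfl (ENNReal.tsum_le_tsum fun k => ?_))
        exact goodCoeff_mul_average_le hc hcheb (hlam.trans_lt h) hδ hδα hM hγ hT f k
    _ ≤ ENNReal.ofReal (1 - η) ^ r + r * (1 * ENNReal.ofReal K) := by
        rw [ENNReal.tsum_mul_right]
        gcongr
        exact tsum_enorm_sq_mul_korobovWeight_sq_le_one hf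
    _ = _ := by
        rw [one_mul, ENNReal.ofReal_add (by positivity) (by positivity),
          ENNReal.ofReal_mul (p := (r : ℝ)) (by positivity), ENNReal.ofReal_natCast,
          ENNReal.ofReal_pow hη'.le, add_comm]

theorem theorem3p5 :
    ∃ C : ℝ → ℝ → ℝ, (∀ lam δ, 0 < C lam δ) ∧
      ∀ (d : ℕ) (α : ℝ) (_ : 1 / 2 < α) (γ : ℕ → ℝ≥0) (_ : ∀ j, γ j ≤ 1)
        (r M : ℕ) (_ : 1 ≤ r) (hM : 2 ≤ M) (η : ℝ) (_ : 0 < η) (_ : η < 1)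
        (_ : sInf ((fun lam : ℝ => 2 * ∏ j : Fin d, zetaFactor α γ lam j) ''
          Set.Ico (1 / 2) α) ≤ (1 - η) * M)
        (sel : ℕ → (Fin r → Fin d → ℕ) → Fin r) (_ : IsArgminRule α γ M sel)
        (lam δ : ℝ) (_ : 1 / 2 ≤ lam) (_ : lam < α) (_ : 0 < δ) (_ : δ ≤ 1 / α),
        worstCaseRMSE α γ (shiftedLaw d r M hM) (shiftedLatticeRule sel) ^ 2 ≤
          ENNReal.ofReal
            (r * C lam δ / (α * (1 - η) ^ (lam * (2 - δ)) * (M : ℝ) ^ (lam * (2 - δ) + 1)) *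
                ∏ j : Fin d, zetaFactor α γ lam j ^ (lam * (2 - δ)) +
              (1 - η) ^ r) := by
  obtain ⟨c, hc, hcheb⟩ := exists_le_card_upperPrimes_mul_log
  -- The 6 comes from the threshold raised to the power 2-δ. The absolute value and the summand 1
  -- only keep the constant positive for every real δ, including 0, where the quotient is 0.
  refine ⟨fun lam δ => (4 + 2 / c) * 6 ^ (lam * (2 - δ)) / |δ| + 1, fun lam δ => by positivity, ?_⟩
  intro d α hα γ hγ r M _ hM η _ hη _ sel hsel lam δ hlam h hδ hδα
  have hlam0 : 0 < lam := by linarith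
  have hα0 : 0 < α := by linarith
  have hM0 : (0 : ℝ) < M := by exact_mod_cast (by omega : 0 < M)
  have hη' : 0 < 1 - η := by linarith
  set s := lam * (2 - δ) with hs
  have hP := prod_zetaFactor_pos (d := d) hlam0 h γ
  have hz : ∀ j : Fin d, 0 < zetaFactor α γ lam j := fun j =>
    zero_lt_one.trans_le (one_le_zetaFactor hlam0 h γ j)
  have hbound : worstCaseRMSE α γ (shiftedLaw d r M hM) (shiftedLatticeRule sel) ^ 2 ≤
      ENNReal.ofReal (r * ((4 + 2 / c) / (δ * α * M) *
        errorThreshold d α γ η M lam ^ (2 - δ)) + (1 - η) ^ r) := by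
    have h1 : worstCaseRMSE α γ (shiftedLaw d r M hM) (shiftedLatticeRule sel) ≤
        ENNReal.ofReal (r * ((4 + 2 / c) / (δ * α * M) *
          errorThreshold d α γ η M lam ^ (2 - δ)) + (1 - η) ^ r) ^ (1 / 2 : ℝ) :=
      iSup₂_le fun f hf => ENNReal.rpow_le_rpow
        (lintegral_shiftedLatticeRule_le hc hcheb hlam h hδ hδα hγ hη hM hsel hf) (by norm_num)
    refine (pow_le_pow_left' h1 2).trans_eq ?_
    rw [← ENNReal.rpow_natCast, ← ENNReal.rpow_mul]
    norm_num
  refine hbound.trans (ENNReal.ofReal_le_ofReal (add_le_add_left ?_ _))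
  have hT : errorThreshold d α γ η M lam ^ (2 - δ) =
      6 ^ s * (∏ j : Fin d, zetaFactor α γ lam j ^ s) / ((1 - η) ^ s * (M : ℝ) ^ s) := by
    rw [errorThreshold, ← Real.rpow_mul (by positivity), ← hs,
      Real.div_rpow (by positivity) (by positivity), Real.mul_rpow (by norm_num) hP.le,
      Real.mul_rpow hη'.le hM0.le, Real.finsetProd_rpow _ _ fun j _ => (hz j).le]
  have hPs : 0 < ∏ j : Fin d, zetaFactor α γ lam j ^ s :=
    Finset.prod_pos fun j _ => Real.rpow_pos_of_pos (hz j) s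
  beta_reduce
  rw [hT, Real.rpow_add hM0, Real.rpow_one, abs_of_pos hδ, ← hs]
  calc _ = r * ((4 + 2 / c) * 6 ^ s / δ) / (α * (1 - η) ^ s * ((M : ℝ) ^ s * M)) *
        ∏ j : Fin d, zetaFactor α γ lam j ^ s := by
        field_simp
    _ ≤ _ := by
        gcongr
        linarith
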